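/- \textbf{Setting.} Let $H^u_i\in\mathbb{R}^{n_y\times n_u}$, $H^y_i\in\mathbb{R}^{n_y\times n_y}$, $H^f_i\in\mathbb{R}^{n_y\times n_f}$ ($i\ge 0$) be the (identified) Markov parameters of a Kalman predictor with respect to input, output and fault, and let $\Sigma_e\in\mathbb{R}^{n_y\times n_y}$ be the (symmetric positive definite) innovation covariance. Assume: $\tau$ is the smallest index with $H^f_\tau\neq 0$, and $H^f_\tau$ has full column rank $n_f$. Fix a left inverse $\Pi$ of $H^f_\tau$ ($\Pi H^f_\tau=I$). \textbf{Identified filter matrices.} Put $\mathscr{H}^f_i=H^f_{\tau+i}$; $\mathscr{H}^z_0=[-H^u_\tau\,\cdots\,-H^u_0\;\;-H^y_\tau\,\cdots\,-H^y_1\;\; I]$ and $\mathscr{H}^z_i=-[H^u_{\tau+i}\;\;0_{n_y\times\tau n_u}\;\;H^y_{\tau+i}\;\;0_{n_y\times\tau n_y}]$ for $i\ge1$; $G_0=\Pi$ and $G_i=-\sum_{j=1}^i G_{i-j}\mathscr{H}^f_jG_0$ for $i\ge 1$; $J_0=I-\mathscr{H}^f_0G_0$ and $J_i=-\sum_{j=0}^i\mathscr{H}^f_{i-j}G_j$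 for $i\ge 1$; $R_i=\sum_{j=0}^iG_{i-j}\mathscr{H}^z_j$ and $Q_i=\sum_{j=0}^iJ_{i-j}\mathscr{H}^z_j$. For $W\in\{R,Q,J\}$ let $\mathcal{H}_W$ be the block-Hankel matrix with $l\ge 1$ block rows and $m\ge 1$ block columns whose block $(i,j)$ is $W_{i+j-1}$, and let $\hat{\mathcal{H}}_W=U_W\Sigma_WV_W^{\mathrm T}$ be the part of a singular value decomposition of $\mathcal{H}_W$ belonging to the $n$ largest singular values, $n$ being the selected filter order. With $\hat{\mathcal C}_R=\Sigma_R^{1/2}V_R^{\mathrm T}$, and $\hat{\mathcal C}_{R,1}$, $\hat{\mathcal C}_{R,2}$ its first and last $m-1$ block columns, set $$\hat\Phi_1=\hat{\mathcal C}_{R,2}\hat{\mathcal C}_{R,1}^{\mathrm T}(\hat{\mathcal C}_{R,1}\hat{\mathcal C}_{R,1}^{\mathrm T})^{-1},\qquad \hat{\mathcal O}_Q=\hat{\mathcal H}_Q\hat{\mathcal C}_R^{\mathrm T}(\hat{\mathcal C}_R\hat{\mathcal C}_R^{\mathrm T})^{-1},\qquad \hat D_2=J_0=I-H^f_\tau\Pi,$$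 let $-\hat C_2$ be the first $n_y$ rows of $\hat{\mathcal O}_Q$, and let $\hat B_1$ be the first $n_y$ columns of $(\hat{\mathcal O}_Q^{\mathrm T}\hat{\mathcal O}_Q)^{-1}\hat{\mathcal O}_Q^{\mathrm T}\hat{\mathcal H}_J$ (the indicated inverses being presupposed). \textbf{Selection of $\alpha$ and the Riccati equation.} Let $H^f_\tau=[U_1\;U_2]\begin{bmatrix}S_H\\0\end{bmatrix}V^{\mathrm T}$ be a singular value decomposition, where $U_1$ has $n_f$ and $U_2$ has $n_y-n_f$ columns, and put $\alpha=U_2^{\mathrm T}$, $\bar C_2=\alpha\hat C_2$, $\bar D_2=\alpha\hat D_2$. Consider the algebraic Riccati equation (ARE) $$P=\hat\Phi_1P\hat\Phi_1^{\mathrm T}+\hat B_1\Sigma_e\hat B_1^{\mathrm T}-(\hat\Phi_1P\bar C_2^{\mathrm T}+\hat B_1\Sigma_e\bar D_2^{\mathrm T})\,\Xi_e^{-1}\,(\hat\Phi_1P\bar C_2^{\mathrm T}+\hat B_1\Sigma_e\bar D_2^{\mathrm T})^{\mathrm T},\qquad \Xi_e=\bar C_2P\bar C_2^{\mathrm T}+\bar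 D_2\Sigma_e\bar D_2^{\mathrm T}.$$ A stabilizing solution is a real symmetric solution $P$ for which $\Xi_e$ is nonsingular and, with $\bar K_r=(\hat\Phi_1P\bar C_2^{\mathrm T}+\hat B_1\Sigma_e\bar D_2^{\mathrm T})\Xi_e^{-1}$, all eigenvalues of $\hat\Phi_1-\bar K_r\bar C_2$ lie in the open unit disc. \textbf{Theorem 2.} The ARE has a unique stabilizing solution $P$ if and only if $$\operatorname{rank}\begin{bmatrix}\hat\Phi_1-\lambda I\\ \hat C_2\end{bmatrix}=n\quad\text{for all }\lambda\in\mathbb{C},\ |\lambda|\ge1,$$ and $$\operatorname{rank}\begin{bmatrix}\hat\Phi_1-e^{j\omega}I&\hat B_1\\ \hat C_2&\hat D_2\end{bmatrix}=n+n_y-n_f\quad\text{for all }\omega\in[0,2\pi].$$ Moreover, if $P$ is a stabilizing solution, the gain $K_r=\bar K_r\alpha$ stabilizes the fault estimation filter: all eigenvalues of its state matrix $\hat\Phi_1-K_r\hat C_2$ lie in the open unit disc. -/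

import Mathlib

open Matrix

noncomputable section

namespace FaultFilter

/-! ### Markov parameters of the filter, computed from those of the predictor -/

/-- Standing rank assumption on the Markov parameters `Hf 0, Hf 1, …` of the fault subsystem:
`τ` is its relative degree (the least index of a nonzero Markov parameter), and `Hf τ` has
full column rank. -/
def FaultRankAssumption {ny nf : ℕ} (Hf : ℕ → Matrix (Fin ny) (Fin nf) ℝ) (τ : ℕ) : Prop :=
  IsLeast {i : ℕ | Hf i ≠ 0} τ ∧ (Hf τ).rank = nf

/-- Index set of the stacked data vector `[u(k); …; u(k+τ); y(k); …; y(k+τ)]`. -/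
abbrev ZIdx (τ nu ny : ℕ) : Type := (Fin (τ + 1) × Fin nu) ⊕ (Fin (τ + 1) × Fin ny)

/-- Markov parameters from the stacked data to the residual `r(k+τ)`:
`𝓗ᶻ₀ = [-Hᵘ_τ … -Hᵘ_0, -Hʸ_τ … -Hʸ_1, I]` and `𝓗ᶻᵢ = -[Hᵘ_{τ+i}, 0, Hʸ_{τ+i}, 0]`, `i > 0`. -/
def seqHz {nu ny : ℕ} (Hu : ℕ → Matrix (Fin ny) (Fin nu) ℝ) (Hy : ℕ → Matrix (Fin ny) (Fin ny) ℝ)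
    (τ : ℕ) : ℕ → Matrix (Fin ny) (ZIdx τ nu ny) ℝ
  | 0 => Matrix.of fun r => Sum.elim
      (fun c => -Hu (τ - (c.1 : ℕ)) r c.2)
      (fun c => if (c.1 : ℕ) = τ then (1 : Matrix (Fin ny) (Fin ny) ℝ) r c.2
        else -Hy (τ - (c.1 : ℕ)) r c.2)
  | i + 1 => Matrix.of fun r => Sum.elim
      (fun c => if (c.1 : ℕ) = 0 then -Hu (τ + (i + 1)) r c.2 else 0)
      (fun c => if (c.1 : ℕ) = 0 then -Hy (τ + (i + 1)) r c.2 else 0)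

/-- Markov parameters from the fault to the residual `r(k+τ)`: `𝓗ᶠᵢ = Hᶠ_{τ+i}`. -/
def seqHf {ny nf : ℕ} (Hf : ℕ → Matrix (Fin ny) (Fin nf) ℝ) (τ i : ℕ) :
    Matrix (Fin ny) (Fin nf) ℝ :=
  Hf (τ + i)

/-- Markov parameters of the open-loop left inverse:
`G₀ = Π`, `Gᵢ = -∑_{j=1}^{i} G_{i-j} 𝓗ᶠⱼ G₀`. -/
def seqG {ny nf : ℕ} (Hf : ℕ → Matrix (Fin ny) (Fin nf) ℝ) (τ : ℕ)
    (Pi : Matrix (Fin nf) (Fin ny) ℝ) : ℕ → Matrix (Fin nf) (Fin ny) ℝ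
  | 0 => Pi
  | i + 1 => -∑ j : Fin (i + 1), seqG Hf τ Pi (i - (j : ℕ)) * seqHf Hf τ ((j : ℕ) + 1) * Pi
termination_by i => i

/-- Markov parameters of the open-loop residual reconstruction error:
`J₀ = I - 𝓗ᶠ₀ G₀`, `Jᵢ = -∑_{j=0}^{i} 𝓗ᶠ_{i-j} Gⱼ`. -/
def seqJ {ny nf : ℕ} (Hf : ℕ → Matrix (Fin ny) (Fin nf) ℝ) (τ : ℕ)
    (Pi : Matrix (Fin nf) (Fin ny) ℝ) : ℕ → Matrix (Fin ny) (Fin ny) ℝ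
  | 0 => 1 - seqHf Hf τ 0 * seqG Hf τ Pi 0
  | i + 1 => -∑ j ∈ Finset.range (i + 2), seqHf Hf τ (i + 1 - j) * seqG Hf τ Pi j

/-- `Rᵢ = ∑_{j=0}^{i} G_{i-j} 𝓗ᶻⱼ`, the open-loop Markov parameters to the fault estimate. -/
def seqR {nu ny nf : ℕ} (Hu : ℕ → Matrix (Fin ny) (Fin nu) ℝ)
    (Hy : ℕ → Matrix (Fin ny) (Fin ny) ℝ) (Hf : ℕ → Matrix (Fin ny) (Fin nf) ℝ) (τ : ℕ)
    (Pi : Matrix (Fin nf) (Fin ny) ℝ) (i : ℕ) : Matrix (Fin nf) (ZIdx τ nu ny) ℝ :=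
  ∑ j ∈ Finset.range (i + 1), seqG Hf τ Pi (i - j) * seqHz Hu Hy τ j

/-- `Qᵢ = ∑_{j=0}^{i} J_{i-j} 𝓗ᶻⱼ`, the open-loop Markov parameters to the residual
reconstruction error. -/
def seqQ {nu ny nf : ℕ} (Hu : ℕ → Matrix (Fin ny) (Fin nu) ℝ)
    (Hy : ℕ → Matrix (Fin ny) (Fin ny) ℝ) (Hf : ℕ → Matrix (Fin ny) (Fin nf) ℝ) (τ : ℕ)
    (Pi : Matrix (Fin nf) (Fin ny) ℝ) (i : ℕ) : Matrix (Fin ny) (ZIdx τ nu ny) ℝ :=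
  ∑ j ∈ Finset.range (i + 1), seqJ Hf τ Pi (i - j) * seqHz Hu Hy τ j

/-! ### Hankel matrices, singular value decomposition and realization -/

/-- Block-Hankel matrix of `W₁, W₂, …` with `l + 1` block rows and `m + 1` block columns
(entries counted from zero, so block `(i, j)` is `W_{i+j+1}`). -/
def hankel {R C : Type*} (W : ℕ → Matrix R C ℝ) (l m : ℕ) :
    Matrix (Fin (l + 1) × R) (Fin (m + 1) × C) ℝ :=
  Matrix.of fun p q => W ((p.1 : ℕ) + (q.1 : ℕ) + 1) p.2 q.2

/-- `U diag(σ) Vᵀ` is the part of a singular value decomposition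
`M = [U U'] [diag(σ) 0; 0 S'] [Vᵀ; V'ᵀ]` that belongs to the `n` largest singular values:
`[U U']` and `[V V']` are orthogonal, `S'` is rectangular diagonal with nonnegative entries, and
no singular value in `S'` exceeds one in `σ`. -/
def IsTruncatedSVD {R C : Type*} [Fintype R] [Fintype C] [DecidableEq R] [DecidableEq C] {n : ℕ}
    (M : Matrix R C ℝ) (U : Matrix R (Fin n) ℝ) (σ : Fin n → ℝ) (V : Matrix C (Fin n) ℝ) : Prop :=
  ∃ (a b : ℕ) (U' : Matrix R (Fin a) ℝ) (S' : Matrix (Fin a) (Fin b) ℝ)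
    (V' : Matrix C (Fin b) ℝ),
    (fromCols U U')ᵀ * fromCols U U' = 1 ∧ fromCols U U' * (fromCols U U')ᵀ = 1 ∧
    (fromCols V V')ᵀ * fromCols V V' = 1 ∧ fromCols V V' * (fromCols V V')ᵀ = 1 ∧
    (∀ i, 0 ≤ σ i) ∧ (∀ i j, 0 ≤ S' i j) ∧
    (∀ (i : Fin a) (j : Fin b), (i : ℕ) ≠ (j : ℕ) → S' i j = 0) ∧
    (∀ k i j, S' i j ≤ σ k) ∧
    M = fromCols U U' * fromBlocks (diagonal σ) 0 0 S' * (fromCols V V')ᵀ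

/-- The estimated controllability matrix `Σ^{1/2} Vᵀ`. -/
def ctrbHat {C : Type*} {n : ℕ} (σ : Fin n → ℝ) (V : Matrix C (Fin n) ℝ) :
    Matrix (Fin n) C ℝ :=
  diagonal (fun i => Real.sqrt (σ i)) * Vᵀ

/-- `Φ̂₁ = 𝒞₂ 𝒞₁ᵀ (𝒞₁ 𝒞₁ᵀ)⁻¹`, with `𝒞₁`, `𝒞₂` the first and the last `m` of the `m + 1` block
columns of the controllability matrix `Ctr`. -/
def phi1Hat {C : Type*} [Fintype C] {n m : ℕ} (Ctr : Matrix (Fin n) (Fin (m + 1) × C) ℝ) :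
    Matrix (Fin n) (Fin n) ℝ :=
  let Ctr₁ : Matrix (Fin n) (Fin m × C) ℝ := Ctr.submatrix id (fun q => (q.1.castSucc, q.2))
  let Ctr₂ : Matrix (Fin n) (Fin m × C) ℝ := Ctr.submatrix id (fun q => (q.1.succ, q.2))
  Ctr₂ * Ctr₁ᵀ * (Ctr₁ * Ctr₁ᵀ)⁻¹

/-- `𝒪_Q = 𝓗̂_Q 𝒞_Rᵀ (𝒞_R 𝒞_Rᵀ)⁻¹`, the observability matrix with `𝓗̂_Q = 𝒪_Q 𝒞_R`. -/
def obsvHat {R C : Type*} [Fintype C] {n : ℕ} (HQ : Matrix R C ℝ) (Ctr : Matrix (Fin n) C ℝ) :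
    Matrix R (Fin n) ℝ :=
  HQ * Ctrᵀ * (Ctr * Ctrᵀ)⁻¹

/-- `Ĉ₂` is minus the first block row of the observability matrix. -/
def c2Hat {n ny l : ℕ} (Obs : Matrix (Fin (l + 1) × Fin ny) (Fin n) ℝ) :
    Matrix (Fin ny) (Fin n) ℝ :=
  -Obs.submatrix (fun i => (0, i)) id

/-- `B̂₁` is the first block column of `𝒞_J = (𝒪_Qᵀ 𝒪_Q)⁻¹ 𝒪_Qᵀ 𝓗̂_J`. -/
def b1Hat {R : Type*} [Fintype R] {n ny m : ℕ} (Obs : Matrix R (Fin n) ℝ)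
    (HJ : Matrix R (Fin (m + 1) × Fin ny) ℝ) : Matrix (Fin n) (Fin ny) ℝ :=
  ((Obsᵀ * Obs)⁻¹ * Obsᵀ * HJ).submatrix id (fun j => (0, j))

/-- `(Φ̂₁, B̂₁, Ĉ₂, D̂₂)` are the matrices of order `n` that the data-driven design computes from
the Markov parameters `Hu`, `Hy`, `Hf` of the predictor, with the left inverse `Pi` of `Hf τ` and
Hankel matrices with `l + 1` block rows and `m + 1` block columns. (Singular value decompositions
are not unique; any of them may be used. Invertibility of the matrices that are inverted in the
formulas is not demanded: what is said of the output below holds without it.) -/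
def IsDesignOutput {nu ny nf n : ℕ} (Hu : ℕ → Matrix (Fin ny) (Fin nu) ℝ)
    (Hy : ℕ → Matrix (Fin ny) (Fin ny) ℝ) (Hf : ℕ → Matrix (Fin ny) (Fin nf) ℝ) (τ : ℕ)
    (Pi : Matrix (Fin nf) (Fin ny) ℝ) (l m : ℕ)
    (Phi : Matrix (Fin n) (Fin n) ℝ) (B : Matrix (Fin n) (Fin ny) ℝ)
    (C : Matrix (Fin ny) (Fin n) ℝ) (D : Matrix (Fin ny) (Fin ny) ℝ) : Prop :=
  ∃ (UR : Matrix (Fin (l + 1) × Fin nf) (Fin n) ℝ) (σR : Fin n → ℝ)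
    (VR : Matrix (Fin (m + 1) × ZIdx τ nu ny) (Fin n) ℝ)
    (UQ : Matrix (Fin (l + 1) × Fin ny) (Fin n) ℝ) (σQ : Fin n → ℝ)
    (VQ : Matrix (Fin (m + 1) × ZIdx τ nu ny) (Fin n) ℝ)
    (UJ : Matrix (Fin (l + 1) × Fin ny) (Fin n) ℝ) (σJ : Fin n → ℝ)
    (VJ : Matrix (Fin (m + 1) × Fin ny) (Fin n) ℝ),
    IsTruncatedSVD (hankel (seqR Hu Hy Hf τ Pi) l m) UR σR VR ∧
    IsTruncatedSVD (hankel (seqQ Hu Hy Hf τ Pi) l m) UQ σQ VQ ∧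
    IsTruncatedSVD (hankel (seqJ Hf τ Pi) l m) UJ σJ VJ ∧
    Phi = phi1Hat (ctrbHat σR VR) ∧
    C = c2Hat (obsvHat (UQ * diagonal σQ * VQᵀ) (ctrbHat σR VR)) ∧
    B = b1Hat (obsvHat (UQ * diagonal σQ * VQᵀ) (ctrbHat σR VR)) (UJ * diagonal σJ * VJᵀ) ∧
    D = seqJ Hf τ Pi 0

/-- The selection of `α`: for a singular value decomposition `H = [U₁ U₂] [S; 0] Vᵀ` with
`[U₁ U₂]` and `V` orthogonal and `S` diagonal with nonnegative entries, `α = U₂ᵀ`. -/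
def IsAlphaSelection {ny nf s : ℕ} (H : Matrix (Fin ny) (Fin nf) ℝ)
    (α : Matrix (Fin s) (Fin ny) ℝ) : Prop :=
  ∃ (U₁ : Matrix (Fin ny) (Fin nf) ℝ) (U₂ : Matrix (Fin ny) (Fin s) ℝ) (S : Fin nf → ℝ)
    (V : Matrix (Fin nf) (Fin nf) ℝ),
    (fromCols U₁ U₂)ᵀ * fromCols U₁ U₂ = 1 ∧ fromCols U₁ U₂ * (fromCols U₁ U₂)ᵀ = 1 ∧
    Vᵀ * V = 1 ∧ V * Vᵀ = 1 ∧ (∀ i, 0 ≤ S i) ∧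
    H = fromCols U₁ U₂ * fromRows (diagonal S) (0 : Matrix (Fin s) (Fin nf) ℝ) * Vᵀ ∧ α = U₂ᵀ

/-! ### The Riccati equation -/

/-- Discrete-time stability: all complex eigenvalues lie in the open unit disc. -/
def IsSchur {n : ℕ} (A : Matrix (Fin n) (Fin n) ℝ) : Prop :=
  ∀ μ ∈ spectrum ℂ (A.map Complex.ofReal), ‖μ‖ < 1

/-- `Ξ = C P Cᵀ + D Σ Dᵀ`. -/
def riccatiXi {n s ny : ℕ} (C : Matrix (Fin s) (Fin n) ℝ) (D : Matrix (Fin s) (Fin ny) ℝ)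
    (Sig : Matrix (Fin ny) (Fin ny) ℝ) (P : Matrix (Fin n) (Fin n) ℝ) :
    Matrix (Fin s) (Fin s) ℝ :=
  C * P * Cᵀ + D * Sig * Dᵀ

/-- The gain `K = (Φ P Cᵀ + B Σ Dᵀ) Ξ⁻¹`. -/
def riccatiGain {n s ny : ℕ} (Phi : Matrix (Fin n) (Fin n) ℝ) (B : Matrix (Fin n) (Fin ny) ℝ)
    (C : Matrix (Fin s) (Fin n) ℝ) (D : Matrix (Fin s) (Fin ny) ℝ)
    (Sig : Matrix (Fin ny) (Fin ny) ℝ) (P : Matrix (Fin n) (Fin n) ℝ) :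
    Matrix (Fin n) (Fin s) ℝ :=
  (Phi * P * Cᵀ + B * Sig * Dᵀ) * (riccatiXi C D Sig P)⁻¹

/-- `P` is a stabilizing solution of the Riccati equation
`P = Φ P Φᵀ + B Σ Bᵀ - (Φ P Cᵀ + B Σ Dᵀ) Ξ⁻¹ (Φ P Cᵀ + B Σ Dᵀ)ᵀ`: it is symmetric, `Ξ` is
nonsingular, the equation holds, and `Φ - K C` is stable for the gain `K` of `P`. -/
def IsStabilizingSolution {n s ny : ℕ} (Phi : Matrix (Fin n) (Fin n) ℝ)
    (B : Matrix (Fin n) (Fin ny) ℝ) (C : Matrix (Fin s) (Fin n) ℝ) (D : Matrix (Fin s) (Fin ny) ℝ)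
    (Sig : Matrix (Fin ny) (Fin ny) ℝ) (P : Matrix (Fin n) (Fin n) ℝ) : Prop :=
  P.IsSymm ∧ IsUnit (riccatiXi C D Sig P).det ∧
  P = Phi * P * Phiᵀ + B * Sig * Bᵀ
    - (Phi * P * Cᵀ + B * Sig * Dᵀ) * (riccatiXi C D Sig P)⁻¹
        * (Phi * P * Cᵀ + B * Sig * Dᵀ)ᵀ ∧
  IsSchur (Phi - riccatiGain Phi B C D Sig P * C)

/-- The matrix `[Φ - λ I; C]`. -/
def obsvPencil {n ny : ℕ} (Phi : Matrix (Fin n) (Fin n) ℝ) (C : Matrix (Fin ny) (Fin n) ℝ)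
    (z : ℂ) : Matrix (Fin n ⊕ Fin ny) (Fin n) ℂ :=
  fromRows (Phi.map Complex.ofReal - z • (1 : Matrix (Fin n) (Fin n) ℂ)) (C.map Complex.ofReal)

/-- The Rosenbrock matrix `[Φ - λ I, B; C, D]`. -/
def rosenbrock {n ny : ℕ} (Phi : Matrix (Fin n) (Fin n) ℝ) (B : Matrix (Fin n) (Fin ny) ℝ)
    (C : Matrix (Fin ny) (Fin n) ℝ) (D : Matrix (Fin ny) (Fin ny) ℝ) (z : ℂ) :
    Matrix (Fin n ⊕ Fin ny) (Fin n ⊕ Fin ny) ℂ :=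
  fromBlocks (Phi.map Complex.ofReal - z • (1 : Matrix (Fin n) (Fin n) ℂ))
    (B.map Complex.ofReal) (C.map Complex.ofReal) (D.map Complex.ofReal)

end FaultFilter

end

set_option linter.unusedSectionVars false

/-! The theorem combines the algebra of the design with the classical theory of the stabilizing
Riccati solution.

Design. The recursion for the `G_i` makes the power series with coefficients `G_i H` (where `H = Hf
τ`) a left inverse of the one with coefficients `Π Hf (τ + i)`. Such an inverse is two-sided, and
this gives `Π J_i = 0` (`mul_seqJ`). Hence `Π` annihilates the `Q_i`, the first block row of their
truncated Hankel matrix, and finally `C` (`IsDesignOutput.mul_outputMatrix`). Since `1 - H Π = E α`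
with `α E = 1`, it follows that `C = E (α C)` and `D = E (α D)`. So projecting by `α` changes none
of the ranks involved, while `α D = α` has full row rank and the noise term of `Ξ` is positive
definite.

Riccati equation. It describes the optimal cost of row trajectories `X(k+1) = X(k) Φ + Y(k) C` with
stage cost `(X B + Y D) S (X B + Y D)ᴴ`; everything rests on `complete_square`. Necessity: a stable
`Φ - K C` gives detectability. At a zero on the unit circle the completed square forces `Y = -X K`,
so `X` is a left eigenvector of the stable closed loop and vanishes. Sufficiency: after adding a
small positive definite `E`, the Riccati iterates from zero increase and are bounded by the cost of
a summable trajectory, which detectability supplies. Their limit is stabilizing because `E` is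
definite. As `E` decreases to zero these solutions decrease to a solution whose closed loop has its
spectrum in the closed disc, and an eigenvalue on the circle would be an excluded zero
(`exists_stabilizing`). Uniqueness: the difference of two stabilizing solutions is a fixed point of
`Z ↦ A Z A'ᴴ` with `A`, `A'` stable. Applied to a solution and its complex conjugate, uniqueness
also shows that for real data the solution found over `ℂ` is real. -/

namespace Riccati

open scoped ComplexOrder MatrixOrder

/-! ### Algebraic identities of the Riccati map -/

section Algebra

variable {n s q p : Type*} [Fintype n] [Fintype s] [Fintype q] [DecidableEq n] [DecidableEq s]

/-- The innovation matrix `C P Cᴴ + D S Dᴴ`. -/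
def xi (C : Matrix s n ℂ) (D : Matrix s q ℂ) (S : Matrix q q ℂ) (P : Matrix n n ℂ) :
    Matrix s s ℂ :=
  C * P * Cᴴ + D * S * Dᴴ

/-- The cross term `Φ P Cᴴ + B S Dᴴ`. -/
def cross (Φ : Matrix n n ℂ) (B : Matrix n q ℂ) (C : Matrix s n ℂ) (D : Matrix s q ℂ)
    (S : Matrix q q ℂ) (P : Matrix n n ℂ) : Matrix n s ℂ :=
  Φ * P * Cᴴ + B * S * Dᴴ

/-- The Kalman gain belonging to `P`. -/
noncomputable def gain (Φ : Matrix n n ℂ) (B : Matrix n q ℂ) (C : Matrix s n ℂ)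
    (D : Matrix s q ℂ) (S : Matrix q q ℂ) (P : Matrix n n ℂ) : Matrix n s ℂ :=
  cross Φ B C D S P * (xi C D S P)⁻¹

/-- The right-hand side of the Riccati equation. -/
noncomputable def ric (Φ : Matrix n n ℂ) (B : Matrix n q ℂ) (C : Matrix s n ℂ)
    (D : Matrix s q ℂ) (S : Matrix q q ℂ) (P : Matrix n n ℂ) : Matrix n n ℂ :=
  Φ * P * Φᴴ + B * S * Bᴴ
    - cross Φ B C D S P * (xi C D S P)⁻¹ * (cross Φ B C D S P)ᴴ

variable {Φ : Matrix n n ℂ} {B : Matrix n q ℂ} {C : Matrix s n ℂ} {D : Matrix s q ℂ}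
  {S : Matrix q q ℂ} {P P' : Matrix n n ℂ}

theorem xi_isHermitian (hS : S.IsHermitian) (hP : P.IsHermitian) : (xi C D S P).IsHermitian := by
  unfold xi Matrix.IsHermitian
  simp [conjTranspose_mul, hS.eq, hP.eq, Matrix.mul_assoc]

theorem gain_mul_xi (h : IsUnit (xi C D S P).det) :
    gain Φ B C D S P * xi C D S P = cross Φ B C D S P := by
  rw [gain, Matrix.mul_assoc, nonsing_inv_mul _ h, Matrix.mul_one]

theorem xi_mul_gain_conjTranspose (hS : S.IsHermitian) (hP : P.IsHermitian)
    (h : IsUnit (xi C D S P).det) :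
    xi C D S P * (gain Φ B C D S P)ᴴ = (cross Φ B C D S P)ᴴ := by
  rw [← gain_mul_xi h, conjTranspose_mul, (xi_isHermitian hS hP).eq]

theorem ric_eq_sub_gain_mul_cross (Φ : Matrix n n ℂ) (B : Matrix n q ℂ) (C : Matrix s n ℂ)
    (D : Matrix s q ℂ) (S : Matrix q q ℂ) (P : Matrix n n ℂ) :
    ric Φ B C D S P = Φ * P * Φᴴ + B * S * Bᴴ - gain Φ B C D S P * (cross Φ B C D S P)ᴴ :=
  rfl

/-- Completion of squares. -/
theorem complete_square (hS : S.IsHermitian) (hP : P.IsHermitian)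
    (h : IsUnit (xi C D S P).det) (X : Matrix p n ℂ) (Y : Matrix p s ℂ) :
    (X * Φ + Y * C) * P * (X * Φ + Y * C)ᴴ + (X * B + Y * D) * S * (X * B + Y * D)ᴴ =
      X * ric Φ B C D S P * Xᴴ + (Y + X * gain Φ B C D S P) * xi C D S P *
        (Y + X * gain Φ B C D S P)ᴴ := by
  have h1 : (Y + X * gain Φ B C D S P) * xi C D S P * (Y + X * gain Φ B C D S P)ᴴ =
      Y * xi C D S P * Yᴴ + X * (gain Φ B C D S P * xi C D S P) * Yᴴ
        + Y * (xi C D S P * (gain Φ B C D S P)ᴴ) * Xᴴ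
        + X * gain Φ B C D S P * (xi C D S P * (gain Φ B C D S P)ᴴ) * Xᴴ := by
    simp only [conjTranspose_add, conjTranspose_mul, Matrix.mul_add, Matrix.add_mul,
      Matrix.mul_assoc]
    abel
  rw [h1, gain_mul_xi h, xi_mul_gain_conjTranspose hS hP h, ric_eq_sub_gain_mul_cross]
  simp only [xi, cross, conjTranspose_add, conjTranspose_mul, conjTranspose_conjTranspose,
    Matrix.mul_add, Matrix.add_mul, Matrix.mul_sub, Matrix.sub_mul, Matrix.mul_assoc, hS.eq, hP.eq]
  abel

/-- The case `X = 1`, `Y = -K` of `complete_square`: replacing the Kalman gain by `K` costs an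
excess weighted by `xi`. -/
theorem ric_add_eq_of_gain (hS : S.IsHermitian) (hP : P.IsHermitian)
    (h : IsUnit (xi C D S P).det) (K : Matrix n s ℂ) :
    (Φ - K * C) * P * (Φ - K * C)ᴴ + (B - K * D) * S * (B - K * D)ᴴ =
      ric Φ B C D S P + (gain Φ B C D S P - K) * xi C D S P * (gain Φ B C D S P - K)ᴴ := by
  have := complete_square (Φ := Φ) (B := B) hS hP h (1 : Matrix n n ℂ) (-K)
  simpa only [Matrix.one_mul, Matrix.neg_mul, ← sub_eq_add_neg, conjTranspose_one, Matrix.mul_one,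
    neg_add_eq_sub] using this

/-- The closed-loop form of the Riccati map. -/
theorem ric_eq_closedLoop (hS : S.IsHermitian) (hP : P.IsHermitian)
    (h : IsUnit (xi C D S P).det) :
    ric Φ B C D S P =
      (Φ - gain Φ B C D S P * C) * P * (Φ - gain Φ B C D S P * C)ᴴ
        + (B - gain Φ B C D S P * D) * S * (B - gain Φ B C D S P * D)ᴴ := by
  rw [ric_add_eq_of_gain hS hP h]
  simp

/-- Differences of values of the Riccati map, in terms of both closed-loop matrices. -/
theorem ric_sub_ric (hS : S.IsHermitian) (hP : P.IsHermitian) (hP' : P'.IsHermitian)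
    (h : IsUnit (xi C D S P).det) (h' : IsUnit (xi C D S P').det) :
    ric Φ B C D S P - ric Φ B C D S P' =
      (Φ - gain Φ B C D S P * C) * (P - P') * (Φ - gain Φ B C D S P' * C)ᴴ := by
  set K := gain Φ B C D S P with hK
  set K' := gain Φ B C D S P' with hK'
  -- With a different gain on each side the product is still affine in `Q`; the last bracket is free
  -- of `Q` and cancels in the difference.
  have e1 : ∀ Q : Matrix n n ℂ, Q.IsHermitian →
      (Φ - K * C) * Q * (Φ - K' * C)ᴴ = Φ * Q * Φᴴ - K * (cross Φ B C D S Q)ᴴ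
        - cross Φ B C D S Q * K'ᴴ + K * xi C D S Q * K'ᴴ
        + (K * D * S * Bᴴ + B * S * Dᴴ * K'ᴴ - K * D * S * Dᴴ * K'ᴴ) := by
    intro Q hQ
    simp only [xi, cross, conjTranspose_add, conjTranspose_sub, conjTranspose_mul,
      conjTranspose_conjTranspose, Matrix.mul_add, Matrix.add_mul, Matrix.mul_sub, Matrix.sub_mul,
      Matrix.mul_assoc, hS.eq, hQ.eq]
    abel
  rw [Matrix.mul_sub, Matrix.sub_mul, e1 P hP, e1 P' hP', ric_eq_sub_gain_mul_cross,
    ric_eq_sub_gain_mul_cross, ← hK, ← hK', gain_mul_xi h, Matrix.mul_assoc K (xi C D S P'),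
    xi_mul_gain_conjTranspose hS hP' h']
  have e2 : K' * (cross Φ B C D S P')ᴴ = cross Φ B C D S P' * K'ᴴ := by
    rw [← xi_mul_gain_conjTranspose hS hP' h', ← gain_mul_xi h', Matrix.mul_assoc]
  rw [e2]
  abel

end Algebra

/-! ### Positivity and the Loewner order -/

section Order

variable {n s q p : Type*} [Fintype n] [Fintype s] [Fintype q] [DecidableEq n] [DecidableEq s]
variable {Φ : Matrix n n ℂ} {B : Matrix n q ℂ} {C : Matrix s n ℂ} {D : Matrix s q ℂ}
  {S : Matrix q q ℂ} {P P' : Matrix n n ℂ}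

theorem xi_posDef (hR : (D * S * Dᴴ).PosDef) (hP : P.PosSemidef) : (xi C D S P).PosDef :=
  PosDef.posSemidef_add (hP.mul_mul_conjTranspose_same C) hR

theorem isUnit_det_xi (hR : (D * S * Dᴴ).PosDef) (hP : P.PosSemidef) :
    IsUnit (xi C D S P).det :=
  (isUnit_iff_isUnit_det _).1 (xi_posDef hR hP).isUnit

theorem ric_posSemidef (hS : S.PosSemidef) (hR : (D * S * Dᴴ).PosDef) (hP : P.PosSemidef) :
    (ric Φ B C D S P).PosSemidef := by
  rw [ric_eq_closedLoop hS.isHermitian hP.isHermitian (isUnit_det_xi hR hP)]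
  exact (hP.mul_mul_conjTranspose_same _).add (hS.mul_mul_conjTranspose_same _)

/-- The Riccati map is monotone in the Loewner order. -/
theorem ric_mono (hS : S.PosSemidef) (hR : (D * S * Dᴴ).PosDef) (hP : P.PosSemidef)
    (h : (P' - P).PosSemidef) : (ric Φ B C D S P' - ric Φ B C D S P).PosSemidef := by
  have hP' : P'.PosSemidef := by simpa using h.add hP
  -- The gain of the larger matrix `P'` is used for both: it is exact at `P'` and only suboptimal at
  -- `P`, so the excess has the right sign.
  have e := ric_eq_closedLoop (Φ := Φ) (B := B) hS.isHermitian hP'.isHermitian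
    (isUnit_det_xi (C := C) hR hP')
  set K' := gain Φ B C D S P'
  have e' := ric_add_eq_of_gain (Φ := Φ) (B := B) hS.isHermitian hP.isHermitian
    (isUnit_det_xi (C := C) hR hP) K'
  have : ric Φ B C D S P' - ric Φ B C D S P = (Φ - K' * C) * (P' - P) * (Φ - K' * C)ᴴ
      + (gain Φ B C D S P - K') * xi C D S P * (gain Φ B C D S P - K')ᴴ := by
    rw [e, eq_sub_of_add_eq e'.symm]
    simp only [Matrix.mul_sub, Matrix.sub_mul]
    abel
  rw [this]
  exact (h.mul_mul_conjTranspose_same _).add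
    ((xi_posDef hR hP).posSemidef.mul_mul_conjTranspose_same _)

theorem eq_zero_of_mul_mul_conjTranspose_eq_zero (hS : S.PosDef) {Z : Matrix p q ℂ}
    (h : Z * S * Zᴴ = 0) : Z = 0 := by
  ext i j
  by_contra hij
  have hne : star (Z i) ≠ 0 := fun h0 => hij (by
    have := congrFun h0 j
    simpa using this)
  have h1 := hS.dotProduct_mulVec_pos hne
  have h2 : star (star (Z i)) ⬝ᵥ S *ᵥ star (Z i) = (Z * S * Zᴴ) i i := by
    rw [star_star, Matrix.dotProduct_mulVec, Matrix.mul_apply]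
    rfl
  rw [h2, h] at h1
  exact lt_irrefl _ h1

theorem eq_zero_of_posSemidef_add_eq_zero {M N : Matrix n n ℂ} (hM : M.PosSemidef)
    (hN : N.PosSemidef) (h : M + N = 0) : M = 0 ∧ N = 0 := by
  have ht : M.trace + N.trace = 0 := by rw [← trace_add, h, trace_zero]
  obtain ⟨h1, h2⟩ := (add_eq_zero_iff_of_nonneg hM.trace_nonneg hN.trace_nonneg).1 ht
  exact ⟨hM.trace_eq_zero_iff.1 h1, hN.trace_eq_zero_iff.1 h2⟩

/-- Writing `M = Nᴴ N`, each entry is at most the mean of two diagonal entries. This turns trace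
bounds into entrywise convergence. -/
theorem norm_apply_le_trace {M : Matrix n n ℂ} (hM : M.PosSemidef) (i j : n) :
    ‖M i j‖ ≤ M.trace.re := by
  obtain ⟨N, rfl⟩ := CStarAlgebra.nonneg_iff_eq_star_mul_self.1 hM.nonneg
  rw [star_eq_conjTranspose]
  have hd : ∀ i, ((Nᴴ * N) i i).re = ∑ k, ‖N k i‖ ^ 2 := by
    intro i
    rw [Matrix.mul_apply, Complex.re_sum]
    refine Finset.sum_congr rfl fun k _ => ?_
    rw [conjTranspose_apply, Complex.star_def, ← Complex.normSq_eq_conj_mul_self,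
      Complex.ofReal_re, Complex.normSq_eq_norm_sq]
  have ht : (Nᴴ * N).trace.re = ∑ i, ∑ k, ‖N k i‖ ^ 2 := by
    rw [trace, Complex.re_sum]
    exact Finset.sum_congr rfl fun i _ => hd i
  have hle : ∀ i, ∑ k, ‖N k i‖ ^ 2 ≤ ∑ i, ∑ k, ‖N k i‖ ^ 2 := fun i =>
    Finset.single_le_sum (f := fun i => ∑ k, ‖N k i‖ ^ 2)
      (fun i _ => Finset.sum_nonneg fun k _ => by positivity) (Finset.mem_univ i)
  have h1 : ‖(Nᴴ * N) i j‖ ≤ ∑ k, (‖N k i‖ ^ 2 + ‖N k j‖ ^ 2) / 2 := by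
    rw [Matrix.mul_apply]
    refine (norm_sum_le _ _).trans (Finset.sum_le_sum fun k _ => ?_)
    rw [norm_mul, conjTranspose_apply, norm_star]
    nlinarith [sq_nonneg (‖N k i‖ - ‖N k j‖)]
  rw [← Finset.sum_div, Finset.sum_add_distrib] at h1
  rw [ht]
  linarith [hle i, hle j]

end Order

/-! ### Stable matrices, Lyapunov equations and limits -/

section Stability

open Filter Topology

variable {n p : Type*} [Fintype n] [DecidableEq n]

/-- All eigenvalues of `A` lie in the open unit disc. -/
def IsStable (A : Matrix n n ℂ) : Prop := ∀ μ ∈ spectrum ℂ A, ‖μ‖ < 1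

/-- Left eigenvectors are the relevant ones for a filter; as one-row matrices they can enter
products such as `X * P * Xᴴ`. -/
theorem mem_spectrum_iff_exists_row {A : Matrix n n ℂ} {μ : ℂ} :
    μ ∈ spectrum ℂ A ↔ ∃ X : Matrix Unit n ℂ, X ≠ 0 ∧ X * A = μ • X := by
  rw [spectrum.mem_iff, isUnit_iff_isUnit_det, isUnit_iff_ne_zero, not_not,
    ← exists_vecMul_eq_zero_iff]
  have key : ∀ v : n → ℂ, v ᵥ* (algebraMap ℂ (Matrix n n ℂ) μ - A) = 0 ↔ v ᵥ* A = μ • v := by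
    intro v
    rw [vecMul_sub, sub_eq_zero, Algebra.algebraMap_eq_smul_one, vecMul_smul, vecMul_one, eq_comm]
  simp only [key]
  constructor
  · rintro ⟨v, hv, h⟩
    refine ⟨Matrix.of fun _ => v, fun h0 => hv (congrFun h0 ()), ?_⟩
    ext i j
    exact congrFun h j
  · rintro ⟨X, hX, h⟩
    refine ⟨X (), fun h0 => hX (by ext i j; exact congrFun h0 j), ?_⟩
    exact congrFun h ()

theorem IsStable.eq_zero_of_mul_eq_smul {A : Matrix n n ℂ} (hA : IsStable A) {μ : ℂ}
    (hμ : 1 ≤ ‖μ‖) {X : Matrix Unit n ℂ} (h : X * A = μ • X) : X = 0 := by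
  by_contra hX
  exact not_lt.2 hμ (hA μ (mem_spectrum_iff_exists_row.2 ⟨X, hX, h⟩))

/-- By Gelfand's formula the norms of the powers are eventually below `r ^ k`, for any `r < 1` above
the spectral radius. -/
theorem tendsto_pow_of_forall_mem_spectrum {R : Type*} [NormedRing R] [NormedAlgebra ℂ R]
    [CompleteSpace R] [Nontrivial R] {a : R} (ha : ∀ z ∈ spectrum ℂ a, ‖z‖ < 1) :
    Tendsto (fun k : ℕ => a ^ k) atTop (𝓝 0) := by
  have h1 : spectralRadius ℂ a < (1 : NNReal) :=
    spectrum.spectralRadius_lt_of_forall_lt a fun z hz => ha z hz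
  obtain ⟨r, hr1, hr2⟩ := ENNReal.lt_iff_exists_nnreal_btwn.1 h1
  have h2 := (spectrum.pow_nnnorm_pow_one_div_tendsto_nhds_spectralRadius a).eventually
    (eventually_lt_nhds hr1)
  have hr : r < 1 := by exact_mod_cast hr2
  rw [tendsto_zero_iff_norm_tendsto_zero]
  refine squeeze_zero' (Eventually.of_forall fun k => norm_nonneg _) ?_
    (tendsto_pow_atTop_nhds_zero_of_lt_one r.2 (by exact_mod_cast hr))
  filter_upwards [h2, eventually_gt_atTop 0] with k hk hk0
  have hk' : (‖a ^ k‖₊ : ENNReal) ≤ (r : ENNReal) ^ k := by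
    have := ENNReal.rpow_le_rpow hk.le (Nat.cast_nonneg (α := ℝ) k)
    rwa [← ENNReal.rpow_mul, one_div, inv_mul_cancel₀ (by exact_mod_cast hk0.ne'),
      ENNReal.rpow_one, ENNReal.rpow_natCast] at this
  have hk'' : ‖a ^ k‖₊ ≤ r ^ k := by exact_mod_cast hk'
  exact_mod_cast hk''

theorem IsStable.tendsto_pow {A : Matrix n n ℂ} (hA : IsStable A) :
    Tendsto (fun k : ℕ => A ^ k) atTop (𝓝 0) := by
  rcases isEmpty_or_nonempty n with hn | hn
  · rw [show (fun k : ℕ => A ^ k) = fun _ => 0 from funext fun k => Subsingleton.elim _ _]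
    exact tendsto_const_nhds
  let _ : NormedRing (Matrix n n ℂ) := Matrix.linftyOpNormedRing
  let _ : NormedAlgebra ℂ (Matrix n n ℂ) := Matrix.linftyOpNormedAlgebra
  have : CompleteSpace (Matrix n n ℂ) := FiniteDimensional.complete ℂ _
  exact tendsto_pow_of_forall_mem_spectrum hA

theorem isClosed_posSemidef : IsClosed {M : Matrix n n ℂ | M.PosSemidef} := by
  have : {M : Matrix n n ℂ | M.PosSemidef} =
      {M | Mᴴ = M} ∩ ⋂ x : n → ℂ, {M | 0 ≤ star x ⬝ᵥ M *ᵥ x} := by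
    ext M
    simp only [Set.mem_ofPred_eq, posSemidef_iff_dotProduct_mulVec, Set.mem_inter_iff,
      Set.mem_iInter]
    rfl
  rw [this]
  refine (isClosed_eq continuous_id.matrix_conjTranspose continuous_id).inter
    (isClosed_iInter fun x => isClosed_le continuous_const ?_)
  exact Continuous.dotProduct continuous_const (continuous_id.matrix_mulVec continuous_const)

/-- A fixed point of `Z ↦ A Z A'ᴴ` vanishes if `A` and `A'` are stable. -/
theorem eq_zero_of_eq_mul_mul_conjTranspose {A A' Z : Matrix n n ℂ} (hA : IsStable A)
    (hA' : IsStable A') (h : Z = A * Z * A'ᴴ) : Z = 0 := by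
  have h1 : ∀ k : ℕ, Z = A ^ k * Z * (A' ^ k)ᴴ := by
    intro k
    induction k with
    | zero => simp
    | succ k ih =>
      rw [pow_succ', pow_succ', conjTranspose_mul]
      calc Z = A * Z * A'ᴴ := h
        _ = A * (A ^ k * Z * (A' ^ k)ᴴ) * A'ᴴ := by rw [← ih]
        _ = _ := by simp only [Matrix.mul_assoc]
  have h2 : Tendsto (fun k : ℕ => A ^ k * Z * (A' ^ k)ᴴ) atTop (𝓝 0) := by
    have hc : Continuous fun M : Matrix n n ℂ => Mᴴ := by fun_prop
    have h3 := (hc.tendsto 0).comp hA'.tendsto_pow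
    have h4 := (hA.tendsto_pow.mul_const Z).mul h3
    rw [zero_mul, zero_mul] at h4
    exact h4
  exact tendsto_nhds_unique tendsto_const_nhds (h2.congr fun k => (h1 k).symm)

/-- Solutions of the Lyapunov equation of a stable matrix are positive semidefinite. -/
theorem IsStable.posSemidef_of_eq {A P N : Matrix n n ℂ} (hA : IsStable A)
    (hN : N.PosSemidef) (h : P = A * P * Aᴴ + N) : P.PosSemidef := by
  -- Iterating the equation, the difference is a sum of `k` terms `A ^ j * N * (A ^ j)ᴴ`; letting
  -- `k` grow leaves `P` itself.
  have h1 : ∀ k : ℕ, (P - A ^ k * P * (A ^ k)ᴴ).PosSemidef := by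
    intro k
    induction k with
    | zero => simpa using PosSemidef.zero
    | succ k ih =>
      have e : P - A ^ (k + 1) * P * (A ^ (k + 1))ᴴ =
          A * (P - A ^ k * P * (A ^ k)ᴴ) * Aᴴ + N := by
        rw [pow_succ', conjTranspose_mul]
        nth_rw 1 [h]
        simp only [Matrix.mul_sub, Matrix.sub_mul, Matrix.mul_assoc]
        abel
      rw [e]
      exact (ih.mul_mul_conjTranspose_same A).add hN
  have h2 : Tendsto (fun k : ℕ => P - A ^ k * P * (A ^ k)ᴴ) atTop
      (𝓝 (P - 0 * P * (0 : Matrix n n ℂ)ᴴ)) := by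
    have hc : Continuous fun M : Matrix n n ℂ => P - M * P * Mᴴ := by fun_prop
    exact (hc.tendsto 0).comp hA.tendsto_pow
  simpa using isClosed_posSemidef.mem_of_tendsto h2 (Eventually.of_forall h1)

/-- Each factor `z - root` of the characteristic polynomial has norm at least `‖z‖ - 1`. The bound
does not depend on `A`, so it survives limits of stable matrices. -/
theorem IsStable.le_norm_det {A : Matrix n n ℂ} (hA : IsStable A) {z : ℂ} (hz : 1 ≤ ‖z‖) :
    (‖z‖ - 1) ^ Fintype.card n ≤ ‖(scalar n z - A).det‖ := by
  rw [← eval_charpoly, (IsAlgClosed.splits A.charpoly).eval_eq_prod_roots_of_monic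
    (charpoly_monic A)]
  have hc : A.charpoly.roots.card = Fintype.card n := by
    rw [IsAlgClosed.card_roots_eq_natDegree, charpoly_natDegree_eq_dim]
  have hr : ∀ w ∈ A.charpoly.roots, ‖w‖ < 1 := fun w hw =>
    hA w (mem_spectrum_iff_isRoot_charpoly.2 (Polynomial.isRoot_of_mem_roots hw))
  rw [← hc]
  generalize A.charpoly.roots = m at hr
  induction m using Multiset.induction_on with
  | empty => simp
  | cons a m ih =>
    rw [Multiset.card_cons, pow_succ', Multiset.map_cons, Multiset.prod_cons, norm_mul]
    have h1 := hr a (Multiset.mem_cons_self a m)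
    have h2 : ‖z‖ - 1 ≤ ‖z - a‖ := by linarith [norm_sub_norm_le z a]
    exact mul_le_mul h2 (ih fun w hw => hr w (Multiset.mem_cons_of_mem hw))
      (pow_nonneg (by linarith) _) (norm_nonneg _)

/-- Eigenvalues of a limit of stable matrices lie in the closed unit disc. -/
theorem norm_le_one_of_tendsto_isStable {A : ℕ → Matrix n n ℂ} {A' : Matrix n n ℂ}
    (hA : ∀ k, IsStable (A k)) (h : Tendsto A atTop (𝓝 A')) {μ : ℂ} (hμ : μ ∈ spectrum ℂ A') :
    ‖μ‖ ≤ 1 := by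
  by_contra! hlt
  have h0 : (scalar n μ - A').det = 0 := by
    rw [spectrum.mem_iff, isUnit_iff_isUnit_det, isUnit_iff_ne_zero, not_not] at hμ
    exact hμ
  have hc : Continuous fun M : Matrix n n ℂ => ‖(scalar n μ - M).det‖ := by fun_prop
  have h1 := (hc.tendsto A').comp h
  have h2 := ge_of_tendsto' h1 fun k => (hA k).le_norm_det hlt.le
  rw [h0, norm_zero] at h2
  exact absurd h2 (not_le.2 (pow_pos (by linarith) _))

/-- A sequence of matrices that is monotone in the Loewner order and has bounded traces
converges. -/
theorem exists_tendsto_of_monotone {P : ℕ → Matrix n n ℂ}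
    (hP : ∀ i j, i ≤ j → (P j - P i).PosSemidef) {c : ℝ} (hc : ∀ k, (P k).trace.re ≤ c) :
    ∃ P', Tendsto P atTop (𝓝 P') := by
  have htr : Monotone fun k => (P k).trace.re := by
    intro i j hij
    have := (Complex.le_def.1 (hP i j hij).trace_nonneg).1
    rw [trace_sub, Complex.sub_re, Complex.zero_re] at this
    exact sub_nonneg.1 this
  have hcauchy : CauchySeq fun k => (P k).trace.re :=
    (tendsto_atTop_ciSup htr ⟨c, by rintro _ ⟨k, rfl⟩; exact hc k⟩).cauchySeq
  have hent : ∀ i j, ∃ a, Tendsto (fun k => P k i j) atTop (𝓝 a) := by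
    intro i j
    refine cauchySeq_tendsto_of_complete ?_
    rw [Metric.cauchySeq_iff'] at hcauchy ⊢
    intro ε hε
    obtain ⟨N, hN⟩ := hcauchy ε hε
    refine ⟨N, fun k hk => lt_of_le_of_lt ?_ (hN k hk)⟩
    have := norm_apply_le_trace (hP N k hk) i j
    rw [trace_sub, Complex.sub_re] at this
    rw [dist_eq_norm, Real.dist_eq]
    exact this.trans (le_abs_self _)
  choose a ha using hent
  exact ⟨Matrix.of a, tendsto_pi_nhds.2 fun i => tendsto_pi_nhds.2 fun j => ha i j⟩

end Stability

/-! ### Hautus condition and summable trajectories -/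

section Stabilizability

variable {V U : Type*} [NormedAddCommGroup V] [NormedSpace ℂ V] [FiniteDimensional ℂ V]
  [NormedAddCommGroup U] [NormedSpace ℂ U] [FiniteDimensional ℂ U]

/-- The initial states from which the system `x(k+1) = A x(k) + b u(k)` has a summable
trajectory. -/
def steerable (A : V →ₗ[ℂ] V) (b : U →ₗ[ℂ] V) : Submodule ℂ V where
  carrier := {x₀ | ∃ (x : ℕ → V) (u : ℕ → U), x 0 = x₀ ∧ (∀ k, x (k + 1) = A (x k) + b (u k)) ∧
    Summable x ∧ Summable u}
  add_mem' := by
    rintro _ _ ⟨x, u, rfl, h, hx, hu⟩ ⟨x', u', rfl, h', hx', hu'⟩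
    refine ⟨x + x', u + u', rfl, fun k => ?_, hx.add hx', hu.add hu'⟩
    simp only [Pi.add_apply, h, h', map_add]
    abel
  zero_mem' := ⟨0, 0, rfl, fun k => by simp, summable_zero, summable_zero⟩
  smul_mem' := by
    rintro c _ ⟨x, u, rfl, h, hx, hu⟩
    refine ⟨c • x, c • u, rfl, fun k => ?_, hx.const_smul c, hu.const_smul c⟩
    simp only [Pi.smul_apply, h, map_smul, smul_add]

theorem summable_of_recurrence {c : ℂ} (hc : ‖c‖ < 1) {y s : ℕ → V} (hs : Summable s)
    (h : ∀ k, y (k + 1) = c • y k + s k) : Summable y := by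
  have : CompleteSpace V := FiniteDimensional.complete ℂ V
  let _ : NormedSpace ℝ V := NormedSpace.restrictScalars ℝ ℂ V
  have : FiniteDimensional ℝ V := FiniteDimensional.complexToReal V
  have hs' : Summable fun k => ‖s k‖ := summable_norm_iff.2 hs
  refine Summable.of_norm (summable_of_sum_range_le
    (c := (‖y 0‖ + ∑' k, ‖s k‖) / (1 - ‖c‖)) (fun k => norm_nonneg _) fun N => ?_)
  rw [le_div_iff₀ (by linarith)]
  have h1 : ∑ k ∈ Finset.range N, ‖y k‖ ≤ ∑ k ∈ Finset.range (N + 1), ‖y k‖ := by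
    rw [Finset.sum_range_succ]
    linarith [norm_nonneg (y N)]
  have h2 : ∑ k ∈ Finset.range N, ‖y (k + 1)‖ ≤
      ‖c‖ * ∑ k ∈ Finset.range N, ‖y k‖ + ∑ k ∈ Finset.range N, ‖s k‖ := by
    rw [Finset.mul_sum, ← Finset.sum_add_distrib]
    refine Finset.sum_le_sum fun k _ => ?_
    rw [h, ← norm_smul]
    exact norm_add_le _ _
  have h3 := hs'.sum_le_tsum (Finset.range N) fun k _ => norm_nonneg _
  rw [Finset.sum_range_succ'] at h1
  linarith

variable {A : V →ₗ[ℂ] V} {b : U →ₗ[ℂ] V}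

theorem mem_steerable_of_map_add_mem {x : V} {u : U} (h : A x + b u ∈ steerable A b) :
    x ∈ steerable A b := by
  obtain ⟨x', u', h0, h1, hx, hu⟩ := h
  refine ⟨fun k => k.casesOn x x', fun k => k.casesOn u u', rfl, ?_, ?_, ?_⟩
  · rintro (_ | k)
    · exact h0
    · exact h1 k
  · exact (summable_nat_add_iff 1).1 hx
  · exact (summable_nat_add_iff 1).1 hu

theorem exists_map_add_mem_steerable {x : V} (h : x ∈ steerable A b) :
    ∃ u, A x + b u ∈ steerable A b := by
  obtain ⟨x', u', rfl, h1, hx, hu⟩ := h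
  exact ⟨u' 0, fun k => x' (k + 1), fun k => u' (k + 1), h1 0, fun k => h1 (k + 1),
    (summable_nat_add_iff 1).2 hx, (summable_nat_add_iff 1).2 hu⟩

/-- Filtering the trajectory that starts at `A x - c x` through `y ↦ c y + s`, which preserves
summability as `‖c‖ < 1`, yields a trajectory from `x`. -/
theorem mem_steerable_of_map_sub_smul_mem {c : ℂ} (hc : ‖c‖ < 1) {x : V}
    (h : A x - c • x ∈ steerable A b) : x ∈ steerable A b := by
  obtain ⟨s, v, h0, h1, hs, hv⟩ := h
  let z : ℕ → V := fun k => Nat.rec x (fun k z => c • z + s k) k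
  let w : ℕ → U := fun k => Nat.rec 0 (fun k w => c • w + v k) k
  have hz : ∀ k, z (k + 1) = c • z k + s k := fun k => rfl
  have hw : ∀ k, w (k + 1) = c • w k + v k := fun k => rfl
  refine ⟨z, w, rfl, fun k => ?_, summable_of_recurrence hc hs hz,
    summable_of_recurrence hc hv hw⟩
  rw [hz]
  induction k with
  | zero =>
    change c • x + s 0 = A x + b 0
    rw [h0, map_zero]
    abel
  | succ k ih =>
    have e : A (z (k + 1)) + b (w (k + 1)) = c • (A (z k) + b (w k)) + (A (s k) + b (v k)) := by
      rw [hz, hw]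
      simp only [map_add, map_smul, smul_add]
      abel
    rw [e, ← ih, ← h1, ← hz]

/-- A dimension count. A state mapped by `A` into `S + range b` can be moved into `S` by one input,
so it lies in `S`. Such states form a space of dimension at least that of `S + range b`, and
therefore `S` is already the whole sum. -/
theorem range_le_steerable : LinearMap.range b ≤ steerable A b := by
  set S := steerable A b
  have hker : LinearMap.ker ((S ⊔ LinearMap.range b).mkQ ∘ₗ A) ≤ S := by
    intro x hx
    rw [LinearMap.mem_ker, LinearMap.comp_apply, Submodule.mkQ_apply,
      Submodule.Quotient.mk_eq_zero, Submodule.mem_sup] at hx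
    obtain ⟨y, hy, _, ⟨u, rfl⟩, hxy⟩ := hx
    refine mem_steerable_of_map_add_mem (u := -u) ?_
    rw [← hxy, map_neg, add_neg_cancel_right]
    exact hy
  have h1 := LinearMap.finrank_range_add_finrank_ker ((S ⊔ LinearMap.range b).mkQ ∘ₗ A)
  have h2 := Submodule.finrank_le (LinearMap.range ((S ⊔ LinearMap.range b).mkQ ∘ₗ A))
  have h3 := (S ⊔ LinearMap.range b).finrank_quotient_add_finrank
  have h4 := Submodule.finrank_mono hker
  have h5 : S = S ⊔ LinearMap.range b :=
    Submodule.eq_of_le_of_finrank_le le_sup_left (by omega)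
  rw [h5]
  exact le_sup_right

theorem map_mem_steerable {x : V} (h : x ∈ steerable A b) : A x ∈ steerable A b := by
  obtain ⟨u, hu⟩ := exists_map_add_mem_steerable h
  have := (steerable A b).sub_mem hu (range_le_steerable ⟨u, rfl⟩)
  simpa using this

/-- Under the Hautus condition for stabilizability every state is the start of a summable
trajectory. -/
theorem steerable_eq_top
    (hH : ∀ c : ℂ, 1 ≤ ‖c‖ → ∀ v : V, ∃ (x : V) (u : U), v = A x - c • x + b u) :
    steerable A b = ⊤ := by
  by_contra hne
  set S := steerable A b with hS
  have hle : S ≤ S.comap A := fun x hx => map_mem_steerable hx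
  have : Nontrivial (V ⧸ S) := Submodule.Quotient.nontrivial_iff.2 hne
  -- An eigenvector of the map induced on `V ⧸ S` gives a contradiction. For `‖c‖ < 1` a lift of it
  -- lies in `S`; for `‖c‖ ≥ 1` the Hautus condition makes the induced map minus `c` surjective,
  -- hence injective.
  obtain ⟨c, hc⟩ := Module.End.exists_eigenvalue (S.mapQ S A hle)
  rcases lt_or_ge ‖c‖ 1 with hlt | hge
  · obtain ⟨y, hy⟩ := hc.exists_hasEigenvector
    obtain ⟨x, rfl⟩ := S.mkQ_surjective y
    refine hy.2 ((Submodule.Quotient.mk_eq_zero S).2 (mem_steerable_of_map_sub_smul_mem hlt ?_))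
    have := hy.apply_eq_smul
    rw [Submodule.mkQ_apply, Submodule.mapQ_apply, ← Submodule.Quotient.mk_smul,
      Submodule.Quotient.eq] at this
    exact this
  · have hsurj : Function.Surjective (S.mapQ S A hle - algebraMap ℂ (Module.End ℂ (V ⧸ S)) c) := by
      intro y
      obtain ⟨v, rfl⟩ := S.mkQ_surjective y
      obtain ⟨x, u, rfl⟩ := hH c hge v
      refine ⟨S.mkQ x, ?_⟩
      have hb : S.mkQ (b u) = 0 := (Submodule.Quotient.mk_eq_zero S).2 (range_le_steerable ⟨u, rfl⟩)
      rw [map_add, hb, add_zero, map_sub, map_smul]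
      rfl
    have hinj := LinearMap.injective_iff_surjective.2 hsurj
    obtain ⟨y, hy⟩ := hc.exists_hasEigenvector
    refine hy.2 (hinj ?_)
    rw [map_zero, LinearMap.sub_apply, hy.apply_eq_smul, Module.algebraMap_end_apply, sub_self]

end Stabilizability

/-! ### Matrix-valued trajectories of detectable pairs -/

section Trajectories

variable {n s : Type*} [Fintype n] [Fintype s] [DecidableEq n]

/-- A detectable pair has a summable error trajectory starting at the identity. -/
theorem exists_summable_trajectory {Φ : Matrix n n ℂ} {C : Matrix s n ℂ}
    (hdet : ∀ (c : ℂ), 1 ≤ ‖c‖ → ∀ v : n → ℂ, ∃ (x : n → ℂ) (y : s → ℂ),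
      v = x ᵥ* Φ - c • x + y ᵥ* C) :
    ∃ (X : ℕ → Matrix n n ℂ) (Y : ℕ → Matrix n s ℂ), X 0 = 1 ∧
      (∀ k, X (k + 1) = X k * Φ + Y k * C) ∧ Summable X ∧ Summable Y := by
  have htop := steerable_eq_top (A := Φ.vecMulLinear) (b := C.vecMulLinear) (by simpa using hdet)
  have h : ∀ i, (1 : Matrix n n ℂ) i ∈ steerable Φ.vecMulLinear C.vecMulLinear := fun i => by
    rw [htop]; trivial
  choose x u h0 h1 hx hu using h
  refine ⟨fun k => Matrix.of fun i => x i k, fun k => Matrix.of fun i => u i k, ?_, fun k => ?_,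
    Pi.summable.2 fun i => hx i, Pi.summable.2 fun i => hu i⟩
  · ext i j
    exact congrFun (h0 i) j
  · ext i j
    exact congrFun (h1 i k) j

end Trajectories

/-! ### Existence of a stabilizing solution by perturbation -/

section Existence

open Filter Topology

variable {n s q p : Type*} [Fintype n] [Fintype s] [Fintype q] [Fintype p] [DecidableEq n]
  [DecidableEq s]
variable {Φ : Matrix n n ℂ} {B : Matrix n q ℂ} {C : Matrix s n ℂ} {D : Matrix s q ℂ}
  {S : Matrix q q ℂ} {P P' : Matrix n n ℂ}

theorem tendsto_inv {ι : Type*} {l : Filter ι} {M : ι → Matrix s s ℂ} {M' : Matrix s s ℂ}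
    (h : Tendsto M l (𝓝 M')) (hM : IsUnit M'.det) :
    Tendsto (fun k => (M k)⁻¹) l (𝓝 M'⁻¹) := by
  simp only [Matrix.inv_def, Ring.inverse_eq_inv']
  have h1 : Continuous fun N : Matrix s s ℂ => N.det := by fun_prop
  have h2 : Continuous fun N : Matrix s s ℂ => N.adjugate := continuous_id.matrix_adjugate
  exact (((h1.tendsto M').comp h).inv₀ hM.ne_zero).smul ((h2.tendsto M').comp h)

theorem tendsto_matrix_mul {ι l m k : Type*} [Fintype m] {f : Filter ι} {M : ι → Matrix l m ℂ}
    {N : ι → Matrix m k ℂ} {M' : Matrix l m ℂ} {N' : Matrix m k ℂ} (hM : Tendsto M f (𝓝 M'))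
    (hN : Tendsto N f (𝓝 N')) : Tendsto (fun i => M i * N i) f (𝓝 (M' * N')) := by
  refine tendsto_pi_nhds.2 fun i => tendsto_pi_nhds.2 fun j => ?_
  simp only [Matrix.mul_apply]
  exact tendsto_finsetSum _ fun a _ =>
    ((tendsto_pi_nhds.1 (tendsto_pi_nhds.1 hM i) a).mul
      (tendsto_pi_nhds.1 (tendsto_pi_nhds.1 hN a) j))

theorem tendsto_xi_inv {ι : Type*} {l : Filter ι} {M : ι → Matrix n n ℂ} (h : Tendsto M l (𝓝 P))
    (hΞ : IsUnit (xi C D S P).det) :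
    Tendsto (fun k => (xi C D S (M k))⁻¹) l (𝓝 (xi C D S P)⁻¹) := by
  have hc : Continuous fun Q : Matrix n n ℂ => xi C D S Q := by
    unfold xi
    fun_prop
  exact tendsto_inv ((hc.tendsto P).comp h) hΞ

theorem continuous_cross : Continuous fun Q : Matrix n n ℂ => cross Φ B C D S Q := by
  unfold cross
  fun_prop

theorem tendsto_gain {ι : Type*} {l : Filter ι} {M : ι → Matrix n n ℂ} (h : Tendsto M l (𝓝 P))
    (hΞ : IsUnit (xi C D S P).det) :
    Tendsto (fun k => gain Φ B C D S (M k)) l (𝓝 (gain Φ B C D S P)) :=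
  tendsto_matrix_mul ((continuous_cross.tendsto P).comp h) (tendsto_xi_inv h hΞ)

theorem tendsto_ric {ι : Type*} {l : Filter ι} {M : ι → Matrix n n ℂ} (h : Tendsto M l (𝓝 P))
    (hΞ : IsUnit (xi C D S P).det) :
    Tendsto (fun k => ric Φ B C D S (M k)) l (𝓝 (ric Φ B C D S P)) := by
  have h1 : Continuous fun Q : Matrix n n ℂ => Φ * Q * Φᴴ + B * S * Bᴴ := by fun_prop
  have h2 : Continuous fun Q : Matrix n n ℂ => (cross Φ B C D S Q)ᴴ :=
    continuous_cross.matrix_conjTranspose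
  exact ((h1.tendsto P).comp h).sub (tendsto_matrix_mul (tendsto_gain h hΞ) ((h2.tendsto P).comp h))

/-- Iterates of `P ↦ ric P + E`, starting at zero. -/
noncomputable def iter (Φ : Matrix n n ℂ) (B : Matrix n q ℂ) (C : Matrix s n ℂ)
    (D : Matrix s q ℂ) (S : Matrix q q ℂ) (E : Matrix n n ℂ) : ℕ → Matrix n n ℂ
  | 0 => 0
  | k + 1 => ric Φ B C D S (iter Φ B C D S E k) + E

variable {E E' : Matrix n n ℂ}

theorem iter_posSemidef (hS : S.PosSemidef) (hR : (D * S * Dᴴ).PosDef) (hE : E.PosSemidef)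
    (k : ℕ) : (iter Φ B C D S E k).PosSemidef := by
  induction k with
  | zero => exact PosSemidef.zero
  | succ k ih => exact (ric_posSemidef hS hR ih).add hE

theorem iter_mono_right (hS : S.PosSemidef) (hR : (D * S * Dᴴ).PosDef) (hE : E.PosSemidef)
    (h : (E' - E).PosSemidef) (k : ℕ) :
    (iter Φ B C D S E' k - iter Φ B C D S E k).PosSemidef := by
  induction k with
  | zero => simpa [iter] using PosSemidef.zero
  | succ k ih =>
    have := (ric_mono (Φ := Φ) (B := B) (C := C) hS hR (iter_posSemidef hS hR hE k) ih).add h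
    rwa [sub_add_sub_comm] at this

theorem iter_mono (hS : S.PosSemidef) (hR : (D * S * Dᴴ).PosDef) (hE : E.PosSemidef) {i j : ℕ}
    (hij : i ≤ j) : (iter Φ B C D S E j - iter Φ B C D S E i).PosSemidef := by
  have hstep : ∀ k, (iter Φ B C D S E (k + 1) - iter Φ B C D S E k).PosSemidef := by
    intro k
    induction k with
    | zero =>
      rw [show iter Φ B C D S E 0 = 0 from rfl, sub_zero]
      exact iter_posSemidef hS hR hE 1
    | succ k ih =>
      have := ric_mono (Φ := Φ) (B := B) (C := C) hS hR (iter_posSemidef hS hR hE k) ih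
      rwa [← add_sub_add_right_eq_sub _ _ E] at this
  induction j, hij using Nat.le_induction with
  | base => simpa using PosSemidef.zero
  | succ j _ ih => simpa using (hstep j).add ih

theorem re_trace_nonneg {M : Matrix p p ℂ} (h : M.PosSemidef) : 0 ≤ M.trace.re :=
  (Complex.le_def.1 h.trace_nonneg).1

/-- The cost of a trajectory bounds the iterates of the Riccati map. -/
theorem re_trace_iter_le (hS : S.PosSemidef) (hR : (D * S * Dᴴ).PosDef) (hE : E.PosSemidef)
    {X : ℕ → Matrix p n ℂ} {Y : ℕ → Matrix p s ℂ}
    (hXY : ∀ k, X (k + 1) = X k * Φ + Y k * C) (N j : ℕ) :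
    (X j * iter Φ B C D S E N * (X j)ᴴ).trace.re ≤ ∑ k ∈ Finset.range N,
      (((X (j + k) * B + Y (j + k) * D) * S * (X (j + k) * B + Y (j + k) * D)ᴴ).trace.re
        + (X (j + k) * E * (X (j + k))ᴴ).trace.re) := by
  induction N generalizing j with
  | zero => simp [iter]
  | succ N ih =>
    have hP := iter_posSemidef (Φ := Φ) (B := B) (C := C) hS hR hE N
    have h1 := congrArg (fun M => (trace M).re) (complete_square (Φ := Φ) (B := B)
      hS.isHermitian hP.isHermitian (isUnit_det_xi (C := C) hR hP) (X j) (Y j))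
    simp only [trace_add, Complex.add_re] at h1
    have h2 := re_trace_nonneg ((xi_posDef (C := C) hR hP).posSemidef.mul_mul_conjTranspose_same
      (Y j + X j * gain Φ B C D S (iter Φ B C D S E N)))
    -- Dynamic programming: one step is paid at time `j`, and the remaining `N` steps start from `X
    -- (j + 1)`.
    have h3 := ih (j + 1)
    rw [hXY] at h3
    rw [iter, Matrix.mul_add, Matrix.add_mul, trace_add, Complex.add_re, Finset.sum_range_succ']
    simp only [Nat.add_zero]
    simp only [show ∀ k, j + 1 + k = j + (k + 1) from fun k => by omega] at h3
    linarith

theorem summable_re_trace {Z : ℕ → Matrix p q ℂ} (hZ : Summable Z) (S : Matrix q q ℂ) :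
    Summable fun k => (Z k * S * (Z k)ᴴ).trace.re := by
  have he : ∀ i j, Summable fun k => ‖Z k i j‖ := fun i j =>
    summable_norm_iff.2 (Pi.summable.1 (Pi.summable.1 hZ i) j)
  have hm : ∀ i a c, Summable fun k => Z k i a * star (Z k i c) := by
    intro i a c
    have h2 : Summable fun k => ‖star (Z k i c)‖ := by simpa only [norm_star] using he i c
    exact (summable_mul_of_summable_norm (he i a) h2).comp_injective
      (i := fun k : ℕ => (k, k)) fun a b h => (Prod.ext_iff.1 h).1
  have hs : Summable fun k => (Z k * S * (Z k)ᴴ).trace := by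
    simp only [trace, diag_apply, Matrix.mul_apply, conjTranspose_apply, Finset.sum_mul]
    refine summable_sum fun i _ => summable_sum fun c _ => summable_sum fun a _ => ?_
    refine ((hm i a c).mul_left (S a c)).congr fun k => ?_
    ring
  exact (Complex.hasSum_re hs.hasSum).summable

theorem summable_matrix_mul {l m k : Type*} [Fintype m] {Z : ℕ → Matrix l m ℂ} (hZ : Summable Z)
    (M : Matrix m k ℂ) : Summable fun i => Z i * M :=
  hZ.map (AddMonoidHom.mk' (fun N : Matrix l m ℂ => N * M) fun _ _ => Matrix.add_mul _ _ _)
    (continuous_id.matrix_mul continuous_const)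

/-- For detectable pairs the iterates are bounded. -/
theorem exists_re_trace_iter_le (hS : S.PosSemidef) (hR : (D * S * Dᴴ).PosDef)
    (hdet : ∀ (c : ℂ), 1 ≤ ‖c‖ → ∀ v : n → ℂ, ∃ (x : n → ℂ) (y : s → ℂ),
      v = x ᵥ* Φ - c • x + y ᵥ* C) (hE : E.PosSemidef) :
    ∃ c : ℝ, ∀ k, (iter Φ B C D S E k).trace.re ≤ c := by
  obtain ⟨X, Y, h0, hXY, hX, hY⟩ := exists_summable_trajectory hdet
  have hs := (summable_re_trace ((summable_matrix_mul hX B).add (summable_matrix_mul hY D)) S).add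
    (summable_re_trace hX E)
  refine ⟨∑' k, (((X k * B + Y k * D) * S * (X k * B + Y k * D)ᴴ).trace.re
    + (X k * E * (X k)ᴴ).trace.re), fun k => ?_⟩
  have h1 := re_trace_iter_le (B := B) hS hR hE hXY k 0
  rw [h0, Matrix.one_mul, conjTranspose_one, Matrix.mul_one] at h1
  simp only [Nat.zero_add] at h1
  exact h1.trans (hs.sum_le_tsum (Finset.range k) fun i _ =>
    add_nonneg (re_trace_nonneg (hS.mul_mul_conjTranspose_same _))
      (re_trace_nonneg (hE.mul_mul_conjTranspose_same _)))

theorem exists_tendsto_iter (hS : S.PosSemidef) (hR : (D * S * Dᴴ).PosDef)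
    (hdet : ∀ (c : ℂ), 1 ≤ ‖c‖ → ∀ v : n → ℂ, ∃ (x : n → ℂ) (y : s → ℂ),
      v = x ᵥ* Φ - c • x + y ᵥ* C) (hE : E.PosSemidef) :
    ∃ P, Tendsto (iter Φ B C D S E) atTop (𝓝 P) ∧ P.PosSemidef ∧ P = ric Φ B C D S P + E := by
  obtain ⟨c, hc⟩ := exists_re_trace_iter_le (B := B) hS hR hdet hE
  obtain ⟨P, hP⟩ := exists_tendsto_of_monotone (fun i j hij => iter_mono hS hR hE hij) hc
  have hPpos : P.PosSemidef := isClosed_posSemidef.mem_of_tendsto hP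
    (Eventually.of_forall fun k => iter_posSemidef hS hR hE k)
  refine ⟨P, hP, hPpos, tendsto_nhds_unique (hP.comp (tendsto_add_atTop_nat 1)) ?_⟩
  exact (tendsto_ric hP (isUnit_det_xi hR hPpos)).add tendsto_const_nhds

/-- Testing the Lyapunov equation on the eigenvector gives `(‖μ‖² - 1) X P Xᴴ + X N Xᴴ = 0`, a
vanishing sum of two positive semidefinite terms. -/
theorem mul_mul_conjTranspose_eq_zero_of_eigen {A P N : Matrix n n ℂ} (hP : P.PosSemidef)
    (hN : N.PosSemidef) (h : P = A * P * Aᴴ + N) {μ : ℂ} (hμ : 1 ≤ ‖μ‖) {X : Matrix Unit n ℂ}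
    (hX : X * A = μ • X) : X * N * Xᴴ = 0 := by
  have h1 : X * P * Xᴴ = ((‖μ‖ ^ 2 : ℝ) : ℂ) • (X * P * Xᴴ) + X * N * Xᴴ := by
    have e : X * (A * P * Aᴴ) * Xᴴ = ((‖μ‖ ^ 2 : ℝ) : ℂ) • (X * P * Xᴴ) := by
      have : X * (A * P * Aᴴ) * Xᴴ = (X * A) * P * (X * A)ᴴ := by
        simp only [conjTranspose_mul, Matrix.mul_assoc]
      rw [this, hX, conjTranspose_smul, Matrix.smul_mul, Matrix.smul_mul, Matrix.mul_smul,
        smul_smul, Complex.star_def, Complex.mul_conj, Complex.normSq_eq_norm_sq]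
    rw [← e, ← Matrix.add_mul, ← Matrix.mul_add, ← h]
  have h2 : (((‖μ‖ ^ 2 - 1 : ℝ) : ℂ) • (X * P * Xᴴ)) + X * N * Xᴴ = 0 := by
    rw [Complex.ofReal_sub, sub_smul, Complex.ofReal_one, one_smul]
    nth_rw 2 [h1]
    abel
  refine (eq_zero_of_posSemidef_add_eq_zero ?_ (hN.mul_mul_conjTranspose_same X) h2).2
  refine (hP.mul_mul_conjTranspose_same X).smul ?_
  exact Complex.zero_le_real.2 (by nlinarith)

theorem isStable_of_eq_ric_add (hS : S.PosSemidef) (hR : (D * S * Dᴴ).PosDef) (hE : E.PosDef)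
    (hP : P.PosSemidef) (h : P = ric Φ B C D S P + E) :
    IsStable (Φ - gain Φ B C D S P * C) := by
  intro μ hμ
  by_contra! hge
  obtain ⟨X, hX0, hX⟩ := mem_spectrum_iff_exists_row.1 hμ
  have hN := hS.mul_mul_conjTranspose_same (B - gain Φ B C D S P * D)
  nth_rw 1 [ric_eq_closedLoop hS.isHermitian hP.isHermitian (isUnit_det_xi hR hP), add_assoc] at h
  have h1 := mul_mul_conjTranspose_eq_zero_of_eigen hP (hN.add hE.posSemidef) h hge hX
  rw [Matrix.mul_add, Matrix.add_mul] at h1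
  exact hX0 (eq_zero_of_mul_mul_conjTranspose_eq_zero hE (eq_zero_of_posSemidef_add_eq_zero
    (hN.mul_mul_conjTranspose_same X) (hE.posSemidef.mul_mul_conjTranspose_same X) h1).2)

/-- Existence of a positive semidefinite stabilizing solution of the Riccati equation. -/
theorem exists_stabilizing (hS : S.PosDef) (hR : (D * S * Dᴴ).PosDef)
    (hdet : ∀ (c : ℂ), 1 ≤ ‖c‖ → ∀ v : n → ℂ, ∃ (x : n → ℂ) (y : s → ℂ),
      v = x ᵥ* Φ - c • x + y ᵥ* C)
    (hcirc : ∀ (z : ℂ), ‖z‖ = 1 → ∀ (X : Matrix Unit n ℂ) (Y : Matrix Unit s ℂ),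
      X * Φ + Y * C = z • X → X * B + Y * D = 0 → X = 0) :
    ∃ P : Matrix n n ℂ, P.PosSemidef ∧ P = ric Φ B C D S P ∧
      IsStable (Φ - gain Φ B C D S P * C) := by
  have hS' := hS.posSemidef
  let E : ℕ → Matrix n n ℂ := fun k => ((1 / ((k : ℝ) + 1) : ℝ) : ℂ) • (1 : Matrix n n ℂ)
  have hE : ∀ k, (E k).PosDef := fun k =>
    PosDef.one.smul (Complex.zero_lt_real.2 Nat.one_div_pos_of_nat)
  have hEmono : ∀ i j, i ≤ j → (E i - E j).PosSemidef := by
    intro i j hij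
    change (((1 / ((i : ℝ) + 1) : ℝ) : ℂ) • (1 : Matrix n n ℂ)
      - ((1 / ((j : ℝ) + 1) : ℝ) : ℂ) • (1 : Matrix n n ℂ)).PosSemidef
    rw [← sub_smul, ← Complex.ofReal_sub]
    exact PosSemidef.one.smul (Complex.zero_le_real.2 (sub_nonneg.2 (Nat.one_div_le_one_div hij)))
  have hE0 : Tendsto E atTop (𝓝 0) := by
    have h1 : Tendsto (fun k : ℕ => ((1 / ((k : ℝ) + 1) : ℝ) : ℂ)) atTop (𝓝 ((0 : ℝ) : ℂ)) :=
      (Complex.continuous_ofReal.tendsto 0).comp tendsto_one_div_add_atTop_nhds_zero_nat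
    have h2 := h1.smul_const (1 : Matrix n n ℂ)
    rwa [Complex.ofReal_zero, zero_smul] at h2
  choose P hlim hpos hfix using fun k =>
    exists_tendsto_iter (B := B) hS' hR hdet (hE k).posSemidef
  have hanti : ∀ i j, i ≤ j → (P i - P j).PosSemidef := fun i j hij =>
    isClosed_posSemidef.mem_of_tendsto ((hlim i).sub (hlim j)) (Eventually.of_forall fun k =>
      iter_mono_right hS' hR (hE j).posSemidef (hEmono i j hij) k)
  -- The `P k` decrease and are bounded below by zero, so the monotone convergence result is applied
  -- to their negatives.
  obtain ⟨P', hP'⟩ := exists_tendsto_of_monotone (P := fun k => -P k) (c := 0)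
    (fun i j hij => by simpa only [neg_sub_neg] using hanti i j hij)
    (fun k => by simpa using re_trace_nonneg (hpos k))
  have hQ : Tendsto P atTop (𝓝 (-P')) := by simpa only [neg_neg] using hP'.neg
  have hQpos : (-P').PosSemidef := isClosed_posSemidef.mem_of_tendsto hQ
    (Eventually.of_forall hpos)
  generalize -P' = Q at hQ hQpos
  have hΞ := isUnit_det_xi (C := C) hR hQpos
  have hQfix : Q = ric Φ B C D S Q := by
    refine tendsto_nhds_unique hQ ?_
    have := (tendsto_ric (Φ := Φ) (B := B) hQ hΞ).add hE0
    rw [add_zero] at this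
    exact this.congr fun k => (hfix k).symm
  refine ⟨Q, hQpos, hQfix, fun μ hμ => ?_⟩
  have hlimA : Tendsto (fun k => Φ - gain Φ B C D S (P k) * C) atTop
      (𝓝 (Φ - gain Φ B C D S Q * C)) :=
    tendsto_const_nhds.sub (tendsto_matrix_mul (tendsto_gain hQ hΞ) tendsto_const_nhds)
  have hle := norm_le_one_of_tendsto_isStable
    (fun k => isStable_of_eq_ric_add hS' hR (hE k) (hpos k) (hfix k)) hlimA hμ
  refine lt_of_le_of_ne hle fun h1 => ?_
  obtain ⟨X, hX0, hX⟩ := mem_spectrum_iff_exists_row.1 hμ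
  have hcl := hQfix
  rw [ric_eq_closedLoop hS'.isHermitian hQpos.isHermitian hΞ] at hcl
  have h2 := mul_mul_conjTranspose_eq_zero_of_eigen hQpos (hS'.mul_mul_conjTranspose_same _) hcl
    h1.ge hX
  have h3 : X * (B - gain Φ B C D S Q * D) = 0 := by
    refine eq_zero_of_mul_mul_conjTranspose_eq_zero hS ?_
    rw [← h2]
    simp only [conjTranspose_mul, Matrix.mul_assoc]
  -- With the optimal choice `Y = -X K`, the eigenvector is a zero direction of the system at `μ`.
  refine hX0 (hcirc μ h1 X (-(X * gain Φ B C D S Q)) ?_ ?_)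
  · rw [← hX, Matrix.mul_sub, Matrix.neg_mul, ← sub_eq_add_neg, Matrix.mul_assoc]
  · rw [← h3, Matrix.mul_sub, Matrix.neg_mul, ← sub_eq_add_neg, Matrix.mul_assoc]

end Existence

/-! ### Uniqueness and necessity -/

section Necessity

variable {n s q : Type*} [Fintype n] [Fintype s] [Fintype q] [DecidableEq n] [DecidableEq s]
variable {Φ : Matrix n n ℂ} {B : Matrix n q ℂ} {C : Matrix s n ℂ} {D : Matrix s q ℂ}
  {S : Matrix q q ℂ} {P P' : Matrix n n ℂ}

/-- Stabilizing solutions of the Riccati equation are unique. -/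
theorem eq_of_stabilizing (hS : S.IsHermitian) (hP : P.IsHermitian) (hP' : P'.IsHermitian)
    (h : IsUnit (xi C D S P).det) (h' : IsUnit (xi C D S P').det) (hfix : P = ric Φ B C D S P)
    (hfix' : P' = ric Φ B C D S P') (hst : IsStable (Φ - gain Φ B C D S P * C))
    (hst' : IsStable (Φ - gain Φ B C D S P' * C)) : P = P' := by
  have e := ric_sub_ric (Φ := Φ) (B := B) hS hP hP' h h'
  rw [← hfix, ← hfix'] at e
  exact sub_eq_zero.1 (eq_zero_of_eq_mul_mul_conjTranspose hst hst' e)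

theorem detectable_of_isStable {K : Matrix n s ℂ} (h : IsStable (Φ - K * C)) {c : ℂ}
    (hc : 1 ≤ ‖c‖) (v : n → ℂ) :
    ∃ (x : n → ℂ) (y : s → ℂ), v = x ᵥ* Φ - c • x + y ᵥ* C := by
  have hu : IsUnit (algebraMap ℂ (Matrix n n ℂ) c - (Φ - K * C)) := by
    by_contra hn
    exact not_lt.2 hc (h c hn)
  obtain ⟨x, hx⟩ := vecMul_surjective_iff_isUnit.2 hu v
  refine ⟨-x, x ᵥ* K, ?_⟩
  rw [← hx]
  simp only [vecMul_sub, Algebra.algebraMap_eq_smul_one, vecMul_smul, vecMul_one,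
    ← vecMul_vecMul, neg_vecMul, smul_neg]
  abel

theorem eq_zero_of_stabilizing (hS : S.PosSemidef) (hR : (D * S * Dᴴ).PosDef)
    (hP : P.IsHermitian) (h : IsUnit (xi C D S P).det) (hfix : P = ric Φ B C D S P)
    (hst : IsStable (Φ - gain Φ B C D S P * C)) {z : ℂ} (hz : ‖z‖ = 1) {X : Matrix Unit n ℂ}
    {Y : Matrix Unit s ℂ} (h1 : X * Φ + Y * C = z • X) (h2 : X * B + Y * D = 0) : X = 0 := by
  -- A stabilizing solution is only assumed Hermitian; the closed-loop Lyapunov equation makes it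
  -- positive semidefinite, and hence `xi` positive definite.
  have hpos : P.PosSemidef := by
    have hcl := hfix
    rw [ric_eq_closedLoop hS.isHermitian hP h] at hcl
    exact hst.posSemidef_of_eq (hS.mul_mul_conjTranspose_same _) hcl
  have e := complete_square (Φ := Φ) (B := B) hS.isHermitian hP h X Y
  rw [h1, h2, ← hfix, conjTranspose_smul, Matrix.smul_mul, Matrix.smul_mul, Matrix.mul_smul,
    smul_smul, Complex.star_def, Complex.mul_conj, Complex.normSq_eq_norm_sq, hz] at e
  simp only [one_pow, Complex.ofReal_one, one_smul, Matrix.zero_mul, add_zero] at e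
  have h3 := eq_zero_of_mul_mul_conjTranspose_eq_zero (xi_posDef hR hpos) (left_eq_add.1 e)
  refine hst.eq_zero_of_mul_eq_smul hz.ge ?_
  rw [Matrix.mul_sub, ← h1, ← Matrix.mul_assoc, eq_neg_of_add_eq_zero_right h3, Matrix.neg_mul,
    sub_neg_eq_add]

end Necessity

end Riccati

namespace FaultFilter

open scoped ComplexOrder MatrixOrder

/-! ### Annihilation of the Markov parameters by the left inverse -/

section Markov

/-- A one-sided inverse of a sequence under convolution is two-sided. -/
theorem sum_mul_eq_zero_of_recursion {R : Type*} [Ring R] {N M : ℕ → R} (hN : N 0 = 1)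
    (hM : M 0 = 1) (h : ∀ i, M (i + 1) = -∑ j ∈ Finset.range (i + 1), M (i - j) * N (j + 1))
    (i : ℕ) : ∑ j ∈ Finset.range (i + 2), N (i + 1 - j) * M j = 0 := by
  have hMN : PowerSeries.mk M * PowerSeries.mk N = 1 := by
    ext k
    rw [PowerSeries.coeff_mul, ← Finset.Nat.sum_antidiagonal_swap]
    simp only [PowerSeries.coeff_mk, Prod.fst_swap, Prod.snd_swap]
    rw [Finset.Nat.sum_antidiagonal_eq_sum_range_succ (fun a b => M b * N a)]
    cases k with
    | zero => simp [hN, hM]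
    | succ k =>
      rw [Finset.sum_range_succ', hN, Nat.sub_zero, mul_one, h, PowerSeries.coeff_one,
        if_neg (Nat.succ_ne_zero k)]
      simp only [Nat.add_sub_add_right, add_neg_cancel]
  -- From `M N = 1` follows `(N M - 1) N = 0`; as `N` has constant term one, it is cancelled
  -- coefficient by coefficient.
  have hF : ∀ k, PowerSeries.coeff k (PowerSeries.mk N * PowerSeries.mk M - 1) = 0 := by
    have h0 : (PowerSeries.mk N * PowerSeries.mk M - 1) * PowerSeries.mk N = 0 := by
      rw [sub_mul, mul_assoc, hMN, mul_one, one_mul, sub_self]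
    intro k
    induction k using Nat.strong_induction_on with
    | _ k ih =>
      have hk := congrArg (PowerSeries.coeff k) h0
      rw [PowerSeries.coeff_mul, Finset.sum_eq_single (k, 0)] at hk
      · simpa only [PowerSeries.coeff_mk, hN, mul_one, map_zero] using hk
      · rintro ⟨a, b⟩ hab hne
        rw [Finset.HasAntidiagonal.mem_antidiagonal] at hab
        have hb : b ≠ 0 := by
          rintro rfl
          exact hne (by simp only [← hab, add_zero])
        rw [ih a (by omega), zero_mul]
      · intro hn
        exact absurd (Finset.HasAntidiagonal.mem_antidiagonal.2 (add_zero k)) hn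
  have hi := hF (i + 1)
  rw [map_sub, PowerSeries.coeff_one, if_neg (Nat.succ_ne_zero i), sub_zero,
    PowerSeries.coeff_mul, ← Finset.Nat.sum_antidiagonal_swap] at hi
  simp only [PowerSeries.coeff_mk, Prod.fst_swap, Prod.snd_swap] at hi
  rwa [Finset.Nat.sum_antidiagonal_eq_sum_range_succ (fun a b => N b * M a)] at hi

variable {nu ny nf : ℕ} {Hf : ℕ → Matrix (Fin ny) (Fin nf) ℝ} {τ : ℕ}
  {Pi : Matrix (Fin nf) (Fin ny) ℝ}

theorem seqG_succ (i : ℕ) : seqG Hf τ Pi (i + 1) =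
    -∑ j ∈ Finset.range (i + 1), seqG Hf τ Pi (i - j) * seqHf Hf τ (j + 1) * Pi := by
  rw [seqG, Fin.sum_univ_eq_sum_range
    (fun j => seqG Hf τ Pi (i - j) * seqHf Hf τ (j + 1) * Pi)]

theorem seqG_mul_mul (hPi : Pi * Hf τ = 1) (i : ℕ) :
    seqG Hf τ Pi i * Hf τ * Pi = seqG Hf τ Pi i := by
  cases i with
  | zero => rw [seqG, hPi, Matrix.one_mul]
  | succ i =>
    rw [seqG_succ, ← Matrix.sum_mul, Matrix.mul_assoc, Matrix.neg_mul, Matrix.mul_assoc,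
      ← Matrix.mul_assoc Pi, hPi, Matrix.one_mul]

/-- Since `G_j = G_j H Π` with `H = Hf τ`, for `i ≥ 1` the product `Π J_i` is minus a convolution
coefficient of the series `Π Hf (τ + ·)` and `G H`, times `Π`. These series are mutually inverse, so
the coefficient is zero. -/
theorem mul_seqJ (hPi : Pi * Hf τ = 1) (i : ℕ) : Pi * seqJ Hf τ Pi i = 0 := by
  have h0 : seqHf Hf τ 0 = Hf τ := rfl
  cases i with
  | zero =>
    rw [seqJ, h0, seqG, Matrix.mul_sub, ← Matrix.mul_assoc, hPi, Matrix.mul_one, Matrix.one_mul,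
      sub_self]
  | succ i =>
    have h := sum_mul_eq_zero_of_recursion (N := fun k => Pi * seqHf Hf τ k)
      (M := fun k => seqG Hf τ Pi k * Hf τ) (by rw [h0, hPi]) (by rw [seqG, hPi]) (fun i => by
        simp only [seqG_succ, Matrix.neg_mul, Matrix.sum_mul]
        refine congrArg _ (Finset.sum_congr rfl fun j _ => ?_)
        rw [← Matrix.mul_assoc (seqG Hf τ Pi (i - j) * Hf τ), seqG_mul_mul hPi, Matrix.mul_assoc,
          hPi, Matrix.mul_one]) i
    have e : ∑ j ∈ Finset.range (i + 2), Pi * (seqHf Hf τ (i + 1 - j) * seqG Hf τ Pi j) =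
        (∑ j ∈ Finset.range (i + 2), Pi * seqHf Hf τ (i + 1 - j) * (seqG Hf τ Pi j * Hf τ)) * Pi := by
      rw [Matrix.sum_mul]
      refine Finset.sum_congr rfl fun j _ => ?_
      conv_lhs => rw [← seqG_mul_mul hPi j]
      simp only [Matrix.mul_assoc]
    rw [seqJ, Matrix.mul_neg, Matrix.mul_sum, e, h, Matrix.zero_mul, neg_zero]

theorem mul_seqQ (hPi : Pi * Hf τ = 1) (Hu : ℕ → Matrix (Fin ny) (Fin nu) ℝ)
    (Hy : ℕ → Matrix (Fin ny) (Fin ny) ℝ) (i : ℕ) : Pi * seqQ Hu Hy Hf τ Pi i = 0 := by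
  rw [seqQ, Matrix.mul_sum]
  refine Finset.sum_eq_zero fun j _ => ?_
  rw [← Matrix.mul_assoc, mul_seqJ hPi, Matrix.zero_mul]

end Markov

/-! ### Consequences for the computed filter matrices -/

section Design

/-- Left null vectors of a matrix are left null vectors of its truncated decomposition. -/
theorem IsTruncatedSVD.mul_eq_zero {p R C : Type*} [Fintype R] [Fintype C] [DecidableEq R]
    [DecidableEq C] {n : ℕ} {M : Matrix R C ℝ} {U : Matrix R (Fin n) ℝ} {σ : Fin n → ℝ}
    {V : Matrix C (Fin n) ℝ} (h : IsTruncatedSVD M U σ V) {X : Matrix p R ℝ} (hX : X * M = 0) :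
    X * (U * diagonal σ * Vᵀ) = 0 := by
  obtain ⟨a, b, U', S', V', -, -, hV, -, -, -, -, -, hM⟩ := h
  -- Orthogonality of `[V V']` strips the right factor, and the left block of what remains is `X U
  -- diag(σ)`.
  have h1 : X * M * fromCols V V' = X * (fromCols U U' * fromBlocks (diagonal σ) 0 0 S') := by
    rw [hM, Matrix.mul_assoc, Matrix.mul_assoc, hV, Matrix.mul_one]
  rw [hX, Matrix.zero_mul, fromCols_mul_fromBlocks, mul_fromCols] at h1
  have h2 : X * (U * diagonal σ) = 0 := by
    ext i j
    have := congrFun (congrFun h1 i) (Sum.inl j)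
    simpa using this.symm
  rw [← Matrix.mul_assoc, h2, Matrix.zero_mul]

variable {nu ny nf n s : ℕ} {Hf : ℕ → Matrix (Fin ny) (Fin nf) ℝ} {τ : ℕ}
  {Pi : Matrix (Fin nf) (Fin ny) ℝ}

/-- All later operations multiply the truncated Hankel matrix from the right, so the null relation
persists whether or not the inverted matrices are invertible. -/
theorem IsDesignOutput.mul_outputMatrix {Hu : ℕ → Matrix (Fin ny) (Fin nu) ℝ}
    {Hy : ℕ → Matrix (Fin ny) (Fin ny) ℝ} (hPi : Pi * Hf τ = 1) {l m : ℕ}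
    {Phi : Matrix (Fin n) (Fin n) ℝ} {B : Matrix (Fin n) (Fin ny) ℝ}
    {C : Matrix (Fin ny) (Fin n) ℝ} {D : Matrix (Fin ny) (Fin ny) ℝ}
    (h : IsDesignOutput Hu Hy Hf τ Pi l m Phi B C D) : Pi * C = 0 := by
  obtain ⟨UR, σR, VR, UQ, σQ, VQ, UJ, σJ, VJ, -, hQ, -, -, rfl, -, -⟩ := h
  let X : Matrix (Fin nf) (Fin (l + 1) × Fin ny) ℝ :=
    Matrix.of fun a p => if p.1 = 0 then Pi a p.2 else 0
  have hX : ∀ {k : Type} (M : Matrix (Fin (l + 1) × Fin ny) k ℝ),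
      X * M = Pi * M.submatrix (fun i => (0, i)) id := by
    intro k M
    ext a c
    simp only [X, Matrix.mul_apply, Matrix.of_apply, Fintype.sum_prod_type, ite_mul, zero_mul,
      submatrix_apply, id_eq]
    rw [Finset.sum_eq_single 0]
    · simp
    · intro b _ hb
      simp [hb]
    · simp
  have h0 : X * hankel (seqQ Hu Hy Hf τ Pi) l m = 0 := by
    rw [hX]
    ext a c
    have := congrFun (congrFun (mul_seqQ hPi Hu Hy (0 + (c.1 : ℕ) + 1)) a) c.2
    exact this
  have h1 := hQ.mul_eq_zero h0
  rw [c2Hat, Matrix.mul_neg, ← hX, obsvHat, ← Matrix.mul_assoc, ← Matrix.mul_assoc, h1,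
    Matrix.zero_mul, Matrix.zero_mul, neg_zero]

theorem IsDesignOutput.feedthrough_eq {Hu : ℕ → Matrix (Fin ny) (Fin nu) ℝ}
    {Hy : ℕ → Matrix (Fin ny) (Fin ny) ℝ} {l m : ℕ}
    {Phi : Matrix (Fin n) (Fin n) ℝ} {B : Matrix (Fin n) (Fin ny) ℝ}
    {C : Matrix (Fin ny) (Fin n) ℝ} {D : Matrix (Fin ny) (Fin ny) ℝ}
    (h : IsDesignOutput Hu Hy Hf τ Pi l m Phi B C D) : D = 1 - Hf τ * Pi := by
  obtain ⟨UR, σR, VR, UQ, σQ, VQ, UJ, σJ, VJ, -, -, -, -, -, -, rfl⟩ := h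
  rw [seqJ, seqG]
  rfl

/-- An orthogonal matrix is square: compare the traces of `Wᵀ W` and `W Wᵀ`. -/
theorem IsAlphaSelection.add_eq {H : Matrix (Fin ny) (Fin nf) ℝ} {α : Matrix (Fin s) (Fin ny) ℝ}
    (h : IsAlphaSelection H α) : nf + s = ny := by
  obtain ⟨U₁, U₂, S, V, h1, h2, -⟩ := h
  have e1 := congrArg trace h1
  have e2 := congrArg trace h2
  rw [trace_mul_comm, e2] at e1
  simp only [trace_one, Fintype.card_sum, Fintype.card_fin] at e1
  exact_mod_cast e1.symm

/-- The projection `1 - H Π` factors through `α`, with a right inverse of `α`. -/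
theorem IsAlphaSelection.exists_rightInverse {H : Matrix (Fin ny) (Fin nf) ℝ}
    {α : Matrix (Fin s) (Fin ny) ℝ} (h : IsAlphaSelection H α) (hPi : Pi * H = 1) :
    α * (1 - H * Pi) = α ∧ ∃ E : Matrix (Fin ny) (Fin s) ℝ, α * E = 1 ∧ 1 - H * Pi = E * α := by
  obtain ⟨U₁, U₂, S, V, h1, h2, -, -, -, hH, rfl⟩ := h
  rw [transpose_fromCols, fromRows_mul_fromCols, ← fromBlocks_one, fromBlocks_inj] at h1
  rw [transpose_fromCols, fromCols_mul_fromRows] at h2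
  rw [fromCols_mul_fromRows, Matrix.mul_zero, add_zero, Matrix.mul_assoc] at hH
  obtain ⟨-, -, h21, h22⟩ := h1
  set N := diagonal S * Vᵀ
  have hαH : U₂ᵀ * H = 0 := by rw [hH, ← Matrix.mul_assoc, h21, Matrix.zero_mul]
  have hD : U₂ᵀ * (1 - H * Pi) = U₂ᵀ := by
    rw [Matrix.mul_sub, ← Matrix.mul_assoc, hαH, Matrix.zero_mul, sub_zero, Matrix.mul_one]
  -- Here `H = U₁ N` and `Π U₁ N = 1`; both factors are square, so they commute. Hence `H Π` fixes
  -- `U₁`, and `1 - H Π` only sees the `U₂` component.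
  have hN : N * (Pi * U₁) = 1 := by
    rw [mul_eq_one_comm, Matrix.mul_assoc, ← hH, hPi]
  have hU : H * Pi * U₁ = U₁ := by
    rw [hH, Matrix.mul_assoc, Matrix.mul_assoc, hN, Matrix.mul_one]
  refine ⟨hD, (1 - H * Pi) * U₂, ?_, ?_⟩
  · rw [← Matrix.mul_assoc, hD, h22]
  · calc 1 - H * Pi = (1 - H * Pi) * (U₁ * U₁ᵀ + U₂ * U₂ᵀ) := by rw [h2, Matrix.mul_one]
      _ = ((1 - H * Pi) * U₁) * U₁ᵀ + (1 - H * Pi) * U₂ * U₂ᵀ := by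
        simp only [Matrix.mul_add, Matrix.mul_assoc]
      _ = _ := by
        rw [Matrix.sub_mul, hU, Matrix.one_mul, sub_self, Matrix.zero_mul, zero_add]

end Design

end FaultFilter

namespace Riccati

open scoped ComplexOrder MatrixOrder

/-! ### Full rank in terms of row vectors -/

section Rank

variable {a b : Type*} [Fintype a] [Fintype b]

theorem rank_eq_card_iff_vecMul_surjective (M : Matrix a b ℂ) :
    M.rank = Fintype.card b ↔ ∀ v, ∃ w, w ᵥ* M = v := by
  rw [← rank_transpose, Matrix.rank, ← Module.finrank_fintype_fun_eq_card ℂ]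
  constructor
  · intro h v
    have ht := Submodule.eq_top_of_finrank_eq h
    obtain ⟨w, hw⟩ := LinearMap.range_eq_top.1 ht v
    exact ⟨w, by rw [← hw, mulVecLin_apply, mulVec_transpose]⟩
  · intro h
    rw [LinearMap.range_eq_top.2, finrank_top]
    intro v
    obtain ⟨w, hw⟩ := h v
    exact ⟨w, by rw [← hw, mulVecLin_apply, mulVec_transpose]⟩

theorem rank_eq_card_iff_vecMul_injective (M : Matrix a b ℂ) :
    M.rank = Fintype.card a ↔ ∀ w, w ᵥ* M = 0 → w = 0 := by
  have h1 := LinearMap.finrank_range_add_finrank_ker Mᵀ.mulVecLin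
  rw [Module.finrank_fintype_fun_eq_card] at h1
  rw [← rank_transpose, Matrix.rank]
  have h2 : (∀ w, w ᵥ* M = 0 → w = 0) ↔ LinearMap.ker Mᵀ.mulVecLin = ⊥ := by
    simp only [LinearMap.ker_eq_bot', mulVecLin_apply, mulVec_transpose]
  rw [h2, ← Submodule.finrank_eq_zero]
  omega

end Rank

/-! ### Complex conjugation of Riccati solutions -/

section Conjugation

variable {n s q : Type*} [Fintype n] [Fintype s] [Fintype q] [DecidableEq n] [DecidableEq s]
variable {Φ : Matrix n n ℂ} {B : Matrix n q ℂ} {C : Matrix s n ℂ} {D : Matrix s q ℂ}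
  {S : Matrix q q ℂ} {P : Matrix n n ℂ}

/-- `P` is a Hermitian stabilizing solution of the Riccati equation. -/
def IsStabilizing (Φ : Matrix n n ℂ) (B : Matrix n q ℂ) (C : Matrix s n ℂ) (D : Matrix s q ℂ)
    (S : Matrix q q ℂ) (P : Matrix n n ℂ) : Prop :=
  P.IsHermitian ∧ IsUnit (xi C D S P).det ∧ P = ric Φ B C D S P ∧
    IsStable (Φ - gain Φ B C D S P * C)

theorem map_inv_of_ringHom {K L : Type*} [Field K] [Field L] (f : K →+* L) (M : Matrix s s K) :
    M⁻¹.map f = (M.map f)⁻¹ := by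
  have hd : (M.map f).det = f M.det := (f.map_det M).symm
  have ha : (M.map f).adjugate = M.adjugate.map f := (f.map_adjugate M).symm
  rw [Matrix.inv_def, Matrix.inv_def, Ring.inverse_eq_inv', Ring.inverse_eq_inv', hd, ha,
    ← map_inv₀]
  ext i j
  simp

local notation "conj" => starRingEnd ℂ

theorem map_conj_conjTranspose {a b : Type*} (M : Matrix a b ℂ) : Mᴴ.map conj = (M.map conj)ᴴ :=
  rfl

theorem map_conj_map_conj {a b : Type*} (M : Matrix a b ℂ) : (M.map conj).map conj = M := by
  ext i j
  simp

theorem xi_map_conj : (xi C D S P).map conj =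
    xi (C.map conj) (D.map conj) (S.map conj) (P.map conj) := by
  simp only [xi, Matrix.map_add conj (map_add conj), Matrix.map_mul, map_conj_conjTranspose]

theorem cross_map_conj : (cross Φ B C D S P).map conj =
    cross (Φ.map conj) (B.map conj) (C.map conj) (D.map conj) (S.map conj) (P.map conj) := by
  simp only [cross, Matrix.map_add conj (map_add conj), Matrix.map_mul, map_conj_conjTranspose]

theorem gain_map_conj : (gain Φ B C D S P).map conj =
    gain (Φ.map conj) (B.map conj) (C.map conj) (D.map conj) (S.map conj) (P.map conj) := by
  simp only [gain, Matrix.map_mul, cross_map_conj, map_inv_of_ringHom, xi_map_conj]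

theorem ric_map_conj : (ric Φ B C D S P).map conj =
    ric (Φ.map conj) (B.map conj) (C.map conj) (D.map conj) (S.map conj) (P.map conj) := by
  simp only [ric, Matrix.map_add conj (map_add conj), Matrix.map_sub conj (map_sub conj),
    Matrix.map_mul, map_conj_conjTranspose, cross_map_conj, map_inv_of_ringHom, xi_map_conj]

theorem IsStable.map_conj {A : Matrix n n ℂ} (hA : IsStable A) : IsStable (A.map conj) := by
  intro μ hμ
  obtain ⟨X, hX0, hX⟩ := mem_spectrum_iff_exists_row.1 hμ
  have h1 := congrArg (fun M => M.map conj) hX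
  simp only [Matrix.map_mul, map_conj_map_conj] at h1
  have h2 : X.map conj * A = conj μ • X.map conj := by
    rw [h1]
    ext i j
    simp
  rw [← Complex.norm_conj]
  refine hA _ (mem_spectrum_iff_exists_row.2 ⟨X.map conj, fun h0 => hX0 ?_, h2⟩)
  rw [← map_conj_map_conj X, h0]
  ext i j
  simp

theorem IsStabilizing.map_conj (h : IsStabilizing Φ B C D S P) :
    IsStabilizing (Φ.map conj) (B.map conj) (C.map conj) (D.map conj) (S.map conj)
      (P.map conj) := by
  obtain ⟨h1, h2, h3, h4⟩ := h
  refine ⟨?_, ?_, ?_, ?_⟩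
  · rw [Matrix.IsHermitian, ← map_conj_conjTranspose, h1.eq]
  · rw [← xi_map_conj]
    have := h2.map conj
    rwa [RingHom.map_det] at this
  · rw [← ric_map_conj, ← h3]
  · have := h4.map_conj
    rwa [Matrix.map_sub conj (map_sub conj), Matrix.map_mul, gain_map_conj] at this

theorem IsStabilizing.eq (hS : S.IsHermitian) {P' : Matrix n n ℂ}
    (h : IsStabilizing Φ B C D S P) (h' : IsStabilizing Φ B C D S P') : P = P' :=
  eq_of_stabilizing hS h.1 h'.1 h.2.1 h'.2.1 h.2.2.1 h'.2.2.1 h.2.2.2 h'.2.2.2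

end Conjugation

end Riccati

namespace FaultFilter

open scoped ComplexOrder MatrixOrder

open Riccati

/-- The complexification of a real matrix. -/
def toC {a b : Type*} (M : Matrix a b ℝ) : Matrix a b ℂ := M.map Complex.ofReal

/-! ### Passage from real to complex matrices -/

section Complexification

variable {a b c : Type*}

theorem toC_mul [Fintype b] (M : Matrix a b ℝ) (N : Matrix b c ℝ) :
    toC (M * N) = toC M * toC N :=
  Matrix.map_mul (f := Complex.ofRealHom)

theorem toC_add (M N : Matrix a b ℝ) : toC (M + N) = toC M + toC N :=
  Matrix.map_add _ Complex.ofReal_add M N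

theorem toC_sub (M N : Matrix a b ℝ) : toC (M - N) = toC M - toC N :=
  Matrix.map_sub _ Complex.ofReal_sub M N

theorem toC_one [DecidableEq a] : toC (1 : Matrix a a ℝ) = 1 :=
  Matrix.map_one _ Complex.ofReal_zero Complex.ofReal_one

theorem toC_transpose (M : Matrix a b ℝ) : toC Mᵀ = (toC M)ᴴ := by
  ext i j
  simp [toC]

theorem toC_inv [Fintype a] [DecidableEq a] (M : Matrix a a ℝ) : toC M⁻¹ = (toC M)⁻¹ :=
  map_inv_of_ringHom Complex.ofRealHom M

theorem det_toC [Fintype a] [DecidableEq a] (M : Matrix a a ℝ) : (toC M).det = (M.det : ℂ) :=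
  (RingHom.map_det Complex.ofRealHom M).symm

theorem toC_injective : Function.Injective (toC : Matrix a b ℝ → Matrix a b ℂ) :=
  Matrix.map_injective Complex.ofReal_injective

theorem toC_map_conj (M : Matrix a b ℝ) : (toC M).map (starRingEnd ℂ) = toC M := by
  ext i j
  simp [toC]

theorem exists_toC_eq {M : Matrix a b ℂ} (h : M.map (starRingEnd ℂ) = M) : ∃ N, toC N = M := by
  refine ⟨M.map Complex.re, ?_⟩
  ext i j
  exact Complex.conj_eq_iff_re.1 (congrFun (congrFun h i) j)

theorem posDef_toC [Fintype a] [DecidableEq a] {M : Matrix a a ℝ} (hM : M.PosDef) :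
    (toC M).PosDef := by
  have hpos : (toC M).PosSemidef := by
    obtain ⟨N, rfl⟩ := CStarAlgebra.nonneg_iff_eq_star_mul_self.1 hM.posSemidef.nonneg
    rw [star_eq_conjTranspose, conjTranspose_eq_transpose_of_trivial, toC_mul, toC_transpose]
    exact posSemidef_conjTranspose_mul_self _
  rw [hpos.posDef_iff_det_ne_zero, det_toC]
  exact Complex.ofReal_ne_zero.2 hM.det_pos.ne'

theorem isSchur_iff {n : ℕ} (A : Matrix (Fin n) (Fin n) ℝ) : IsSchur A ↔ IsStable (toC A) :=
  Iff.rfl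

variable {n s ny : ℕ} {Phi : Matrix (Fin n) (Fin n) ℝ} {B : Matrix (Fin n) (Fin ny) ℝ}
  {C : Matrix (Fin s) (Fin n) ℝ} {D : Matrix (Fin s) (Fin ny) ℝ}
  {Sig : Matrix (Fin ny) (Fin ny) ℝ} {P : Matrix (Fin n) (Fin n) ℝ}

theorem toC_riccatiXi :
    toC (riccatiXi C D Sig P) = xi (toC C) (toC D) (toC Sig) (toC P) := by
  simp only [riccatiXi, xi, toC_add, toC_mul, toC_transpose]

theorem toC_riccatiGain : toC (riccatiGain Phi B C D Sig P) =
    gain (toC Phi) (toC B) (toC C) (toC D) (toC Sig) (toC P) := by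
  simp only [riccatiGain, gain, cross, toC_add, toC_mul, toC_transpose, toC_inv, toC_riccatiXi]

theorem isStabilizingSolution_iff : IsStabilizingSolution Phi B C D Sig P ↔
    IsStabilizing (toC Phi) (toC B) (toC C) (toC D) (toC Sig) (toC P) := by
  unfold IsStabilizingSolution IsStabilizing
  refine and_congr ?_ (and_congr ?_ (and_congr ?_ ?_))
  · rw [Matrix.IsHermitian, ← toC_transpose, toC_injective.eq_iff, Matrix.IsSymm]
  · rw [← toC_riccatiXi, det_toC, isUnit_iff_ne_zero, isUnit_iff_ne_zero, Complex.ofReal_ne_zero]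
  · rw [← toC_injective.eq_iff]
    simp only [ric, cross, toC_add, toC_sub, toC_mul, toC_transpose, toC_inv, toC_riccatiXi]
  · rw [isSchur_iff, toC_sub, toC_mul, toC_riccatiGain]

end Complexification

/-! ### Rank conditions and the real Riccati theorem -/

section Conditions

variable {n s ny : ℕ} {Phi : Matrix (Fin n) (Fin n) ℝ} {B : Matrix (Fin n) (Fin ny) ℝ}
  {C : Matrix (Fin s) (Fin n) ℝ} {D : Matrix (Fin s) (Fin ny) ℝ}
  {Sig : Matrix (Fin ny) (Fin ny) ℝ}

theorem rank_obsvPencil_eq_iff (z : ℂ) : (obsvPencil Phi C z).rank = n ↔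
    ∀ v : Fin n → ℂ, ∃ (x : Fin n → ℂ) (y : Fin s → ℂ),
      v = x ᵥ* toC Phi - z • x + y ᵥ* toC C := by
  have h := rank_eq_card_iff_vecMul_surjective (obsvPencil Phi C z)
  rw [Fintype.card_fin] at h
  rw [h]
  have key : ∀ w : Fin n ⊕ Fin s → ℂ, w ᵥ* obsvPencil Phi C z =
      (w ∘ Sum.inl) ᵥ* toC Phi - z • (w ∘ Sum.inl) + (w ∘ Sum.inr) ᵥ* toC C := by
    intro w
    rw [obsvPencil, vecMul_fromRows, vecMul_sub, vecMul_smul, vecMul_one]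
    rfl
  simp only [key]
  refine forall_congr' fun v => ⟨?_, ?_⟩
  · rintro ⟨w, rfl⟩
    exact ⟨_, _, rfl⟩
  · rintro ⟨x, y, rfl⟩
    exact ⟨Sum.elim x y, rfl⟩

/-- The rectangular system matrix `[Φ - z, B; C, D]`. -/
def systemPencil (Phi : Matrix (Fin n) (Fin n) ℝ) (B : Matrix (Fin n) (Fin ny) ℝ)
    (C : Matrix (Fin s) (Fin n) ℝ) (D : Matrix (Fin s) (Fin ny) ℝ) (z : ℂ) :
    Matrix (Fin n ⊕ Fin s) (Fin n ⊕ Fin ny) ℂ :=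
  fromBlocks (toC Phi - z • (1 : Matrix (Fin n) (Fin n) ℂ)) (toC B) (toC C) (toC D)

/-- Only `X = 0` has to be checked: then `Y D = 0`, and the right inverse of `D` gives `Y = 0`. -/
theorem rank_systemPencil_eq_iff {E : Matrix (Fin ny) (Fin s) ℝ} (hE : D * E = 1) (z : ℂ) :
    (systemPencil Phi B C D z).rank = n + s ↔
      ∀ (X : Matrix Unit (Fin n) ℂ) (Y : Matrix Unit (Fin s) ℂ),
        X * toC Phi + Y * toC C = z • X → X * toC B + Y * toC D = 0 → X = 0 := by
  have h := rank_eq_card_iff_vecMul_injective (systemPencil Phi B C D z)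
  rw [Fintype.card_sum, Fintype.card_fin, Fintype.card_fin] at h
  rw [h]
  have key : ∀ w : Fin n ⊕ Fin s → ℂ, w ᵥ* systemPencil Phi B C D z =
      Sum.elim ((w ∘ Sum.inl) ᵥ* toC Phi - z • (w ∘ Sum.inl) + (w ∘ Sum.inr) ᵥ* toC C)
        ((w ∘ Sum.inl) ᵥ* toC B + (w ∘ Sum.inr) ᵥ* toC D) := by
    intro w
    rw [systemPencil, vecMul_fromBlocks, vecMul_sub, vecMul_smul, vecMul_one]
  constructor
  · intro hw X Y h1 h2
    have h3 : Sum.elim (X ()) (Y ()) = 0 := by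
      refine hw _ ?_
      rw [key, Sum.elim_comp_inl, Sum.elim_comp_inr]
      have e1 : X () ᵥ* toC Phi - z • X () + Y () ᵥ* toC C = 0 := by
        have : X () ᵥ* toC Phi + Y () ᵥ* toC C = z • X () := congrFun h1 ()
        rw [← this]
        abel
      have e2 : X () ᵥ* toC B + Y () ᵥ* toC D = 0 := congrFun h2 ()
      rw [e1, e2]
      ext (i | i) <;> rfl
    ext i j
    exact congrFun h3 (Sum.inl j)
  · intro hXY w hw
    rw [key] at hw
    have e1 : (w ∘ Sum.inl) ᵥ* toC Phi - z • (w ∘ Sum.inl) + (w ∘ Sum.inr) ᵥ* toC C = 0 :=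
      funext fun i => congrFun hw (Sum.inl i)
    have e2 : (w ∘ Sum.inl) ᵥ* toC B + (w ∘ Sum.inr) ᵥ* toC D = 0 :=
      funext fun i => congrFun hw (Sum.inr i)
    have hX := hXY (Matrix.of fun _ => w ∘ Sum.inl) (Matrix.of fun _ => w ∘ Sum.inr)
      (by
        funext _
        change (w ∘ Sum.inl) ᵥ* toC Phi + (w ∘ Sum.inr) ᵥ* toC C = z • (w ∘ Sum.inl)
        rw [← sub_eq_zero, ← e1]
        abel)
      (by
        funext _
        exact e2)
    have hl : w ∘ Sum.inl = 0 := congrFun hX ()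
    rw [hl, zero_vecMul, zero_add] at e2
    have hr : w ∘ Sum.inr = 0 := by
      have := congrArg (fun v => v ᵥ* toC E) e2
      simpa only [vecMul_vecMul, ← toC_mul, hE, toC_one, vecMul_one, zero_vecMul] using this
    ext (i | i)
    · exact congrFun hl i
    · exact congrFun hr i

/-- For real data with `D` of full row rank, existence and uniqueness of a stabilizing solution is
equivalent to detectability and absence of zeros on the unit circle. -/
theorem existsUnique_isStabilizingSolution_iff (hSig : Sig.PosDef) {E : Matrix (Fin ny) (Fin s) ℝ}
    (hE : D * E = 1) :
    (∃! P, IsStabilizingSolution Phi B C D Sig P) ↔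
      (∀ z : ℂ, 1 ≤ ‖z‖ → (obsvPencil Phi C z).rank = n) ∧
      (∀ z : ℂ, ‖z‖ = 1 → (systemPencil Phi B C D z).rank = n + s) := by
  simp only [rank_obsvPencil_eq_iff, rank_systemPencil_eq_iff hE, isStabilizingSolution_iff]
  have hS := posDef_toC hSig
  have hR : (toC D * toC Sig * (toC D)ᴴ).PosDef := by
    refine hS.mul_mul_conjTranspose_same fun v w hvw => ?_
    have := congrArg (fun v => v ᵥ* toC E) hvw
    simpa only [vecMul_vecMul, ← toC_mul, hE, toC_one, vecMul_one] using this
  constructor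
  · rintro ⟨P, ⟨h1, h2, h3, h4⟩, -⟩
    exact ⟨fun z hz v => detectable_of_isStable h4 hz v, fun z hz X Y hXY hXY' =>
      eq_zero_of_stabilizing hS.posSemidef hR h1 h2 h3 h4 hz hXY hXY'⟩
  · rintro ⟨h1, h2⟩
    obtain ⟨P, hP, hfix, hst⟩ := exists_stabilizing hS hR h1 h2
    have hP' : IsStabilizing (toC Phi) (toC B) (toC C) (toC D) (toC Sig) P :=
      ⟨hP.isHermitian, isUnit_det_xi hR hP, hfix, hst⟩
    -- The data are real, so the conjugate solves the same problem, and uniqueness makes the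
    -- solution real.
    have hconj := hP'.map_conj
    simp only [toC_map_conj] at hconj
    obtain ⟨Q, rfl⟩ := exists_toC_eq (hconj.eq hS.isHermitian hP')
    exact ⟨Q, hP', fun Q' hQ' => toC_injective (IsStabilizing.eq hS.isHermitian hQ' hP')⟩

/-- Left multiplication by `diag(1, E)` cannot raise the rank. Used once with `α` and once with its
right inverse, it gives equality. -/
theorem rank_obsvPencil_mul {k : ℕ} {C : Matrix (Fin k) (Fin n) ℝ} (E : Matrix (Fin s) (Fin k) ℝ)
    (z : ℂ) : (obsvPencil Phi (E * C) z).rank ≤ (obsvPencil Phi C z).rank := by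
  have : obsvPencil Phi (E * C) z = (fromBlocks 1 0 0 (toC E) :
      Matrix (Fin n ⊕ Fin s) (Fin n ⊕ Fin k) ℂ) * obsvPencil Phi C z := by
    have := toC_mul E C
    unfold toC at this
    rw [obsvPencil, obsvPencil, fromBlocks_mul_fromRows, Matrix.one_mul, Matrix.zero_mul,
      Matrix.zero_mul, add_zero, zero_add, this]
    rfl
  rw [this]
  exact rank_mul_le_right _ _

theorem rank_systemPencil_mul {k : ℕ} {C : Matrix (Fin k) (Fin n) ℝ}
    {D : Matrix (Fin k) (Fin ny) ℝ} (E : Matrix (Fin s) (Fin k) ℝ) (z : ℂ) :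
    (systemPencil Phi B (E * C) (E * D) z).rank ≤ (systemPencil Phi B C D z).rank := by
  have : systemPencil Phi B (E * C) (E * D) z =
      (fromBlocks 1 0 0 (toC E) : Matrix (Fin n ⊕ Fin s) (Fin n ⊕ Fin k) ℂ)
        * systemPencil Phi B C D z := by
    rw [systemPencil, systemPencil, fromBlocks_multiply, toC_mul, toC_mul]
    simp only [Matrix.one_mul, Matrix.zero_mul, add_zero, zero_add]
  rw [this]
  exact rank_mul_le_right _ _

theorem forall_norm_eq_one_iff {p : ℂ → Prop} : (∀ z : ℂ, ‖z‖ = 1 → p z) ↔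
    ∀ ω ∈ Set.Icc (0 : ℝ) (2 * Real.pi), p (Complex.exp (Complex.I * (ω : ℂ))) := by
  constructor
  · intro h ω _
    refine h _ ?_
    rw [mul_comm]
    exact Complex.norm_exp_ofReal_mul_I ω
  · intro h z hz
    have hzarg : Complex.exp (Complex.I * (z.arg : ℂ)) = z := by
      have := Complex.norm_mul_exp_arg_mul_I z
      rwa [hz, Complex.ofReal_one, one_mul, mul_comm] at this
    have h1 := Complex.neg_pi_lt_arg z
    have h2 := Complex.arg_le_pi z
    -- The argument lies in `(-π, π]`; negative values are shifted by a full period into `[0, 2π]`.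
    rcases le_or_gt 0 z.arg with h0 | h0
    · have := h z.arg ⟨h0, by linarith [Real.pi_pos]⟩
      rwa [hzarg] at this
    · have := h (z.arg + 2 * Real.pi) ⟨by linarith, by linarith⟩
      have e : Complex.I * ((z.arg + 2 * Real.pi : ℝ) : ℂ) =
          Complex.I * (z.arg : ℂ) + 2 * Real.pi * Complex.I := by
        push_cast
        ring
      rwa [e, Complex.exp_periodic, hzarg] at this

end Conditions

end FaultFilter

/-! ### The theorem: transfer between projected and full data -/

theorem theorem2 {nu ny nf n s : ℕ}
    -- Markov parameters of the predictor, from the input, the output and the fault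
    (Hu : ℕ → Matrix (Fin ny) (Fin nu) ℝ) (Hy : ℕ → Matrix (Fin ny) (Fin ny) ℝ)
    (Hf : ℕ → Matrix (Fin ny) (Fin nf) ℝ) (τ : ℕ)
    (hrank : FaultFilter.FaultRankAssumption Hf τ)
    -- innovation covariance
    (Sig : Matrix (Fin ny) (Fin ny) ℝ) (hSig : Sig.PosDef)
    -- the chosen left inverse, the Hankel sizes and the computed filter matrices
    (Pi : Matrix (Fin nf) (Fin ny) ℝ) (hPi : Pi * Hf τ = 1) (l m : ℕ)
    (Phi : Matrix (Fin n) (Fin n) ℝ) (B : Matrix (Fin n) (Fin ny) ℝ)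
    (C : Matrix (Fin ny) (Fin n) ℝ) (D : Matrix (Fin ny) (Fin ny) ℝ)
    (hdesign : FaultFilter.IsDesignOutput Hu Hy Hf τ Pi l m Phi B C D)
    (α : Matrix (Fin s) (Fin ny) ℝ) (hα : FaultFilter.IsAlphaSelection (Hf τ) α) :
    ((∃! P : Matrix (Fin n) (Fin n) ℝ,
        FaultFilter.IsStabilizingSolution Phi B (α * C) (α * D) Sig P) ↔
      (∀ z : ℂ, 1 ≤ ‖z‖ → (FaultFilter.obsvPencil Phi C z).rank = n) ∧
      (∀ ω ∈ Set.Icc (0 : ℝ) (2 * Real.pi),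
        (FaultFilter.rosenbrock Phi B C D (Complex.exp (Complex.I * (ω : ℂ)))).rank + nf
          = n + ny)) ∧
    (∀ P : Matrix (Fin n) (Fin n) ℝ,
      FaultFilter.IsStabilizingSolution Phi B (α * C) (α * D) Sig P →
        FaultFilter.IsSchur
          (Phi - FaultFilter.riccatiGain Phi B (α * C) (α * D) Sig P * α * C)) := by
  obtain ⟨hαD, E, hαE, hE⟩ := hα.exists_rightInverse hPi
  have hs := hα.add_eq
  have hD := hdesign.feedthrough_eq
  -- `E α = 1 - H Π` with `H = Hf τ`, and `Π C = 0`.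
  have hC : E * (α * C) = C := by
    rw [← Matrix.mul_assoc, ← hE, Matrix.sub_mul, Matrix.mul_assoc,
      hdesign.mul_outputMatrix hPi, Matrix.mul_zero, sub_zero, Matrix.one_mul]
  have hED : E * (α * D) = D := by
    rw [hD, hαD, ← hE]
  refine ⟨?_, fun P hP => ?_⟩
  · rw [FaultFilter.existsUnique_isStabilizingSolution_iff hSig (E := E) (by rw [hD, hαD, hαE]),
      FaultFilter.forall_norm_eq_one_iff]
    refine and_congr (forall₂_congr fun z _ => ?_) (forall₂_congr fun ω _ => ?_)
    · have h1 := FaultFilter.rank_obsvPencil_mul (Phi := Phi) (C := C) α z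
      have h2 := FaultFilter.rank_obsvPencil_mul (Phi := Phi) (C := α * C) E z
      rw [hC] at h2
      rw [le_antisymm h1 h2]
    · have h1 := FaultFilter.rank_systemPencil_mul (Phi := Phi) (B := B) (C := C) (D := D) α
        (Complex.exp (Complex.I * (ω : ℂ)))
      have h2 := FaultFilter.rank_systemPencil_mul (Phi := Phi) (B := B) (C := α * C)
        (D := α * D) E (Complex.exp (Complex.I * (ω : ℂ)))
      rw [hC, hED] at h2
      rw [le_antisymm h1 h2]
      change (FaultFilter.rosenbrock Phi B C D _).rank = n + s ↔ _
      omega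
  · rw [Matrix.mul_assoc]
    exact hP.2.2.2
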